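/- Let $\mathcal O$ be a complete discrete valuation ring with finite residue field $k$ of cardinality $q$ and fraction field $K$. Let $K'/K$ be a finite unramified extension, with ring of integers $\mathcal O'$ and residue field $k'$ of cardinality $q^r$. Fix uniformizers $\pi\in\mathcal O$ and $\varpi\in\mathcal O'$. Let $\mathbb W_{\mathcal O}=\mathrm{Spec}\,\mathcal O[X_0,X_1,\dots]$ be the ring scheme of ramified Witt vectors over $\mathcal O$: for every $\mathcal O$-algebra $B$, $\mathbb W_{\mathcal O}(B)=B^{\mathbb N}$ as a set, and the ring structure is the unique one, functorial in $B$, for which all the Witt polynomials $$\Phi_n=X_0^{q^n}+\pi X_1^{q^{n-1}}+\dots+\pi^nX_n\qquad(n\ge 0)$$ define ring homomorphisms $\mathbb W_{\mathcal O}(B)\to B$. Let $\mathbb W_{\mathcal O'}$ be defined in the same way from $\varpi$ and the polynomials $\Phi'_n=X_0^{q^{rn}}+\varpi X_1^{q^{r(n-1)}}+\dots+\varpi^nX_n$. Let $u\colon \mathbb W_{\mathcal O}\times_{\mathcal O}\mathrm{Spec}\,\mathcal O'\to\mathbb W_{\mathcal O'}$ be Drinfeld's morphism, i.e. the unique morphism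 of schemes over $\mathrm{Spec}\,\mathcal O'$ (automatically a morphism of ring schemes) such that $\Phi'_n\circ u=\Phi_{rn}$ for all $n\ge 0$, and let $$u_{k'}\colon \mathbb W_{\mathcal O}\times_{\mathcal O}\mathrm{Spec}\,k'\to\mathbb W_{\mathcal O'}\times_{\mathcal O'}\mathrm{Spec}\,k'$$ be its restriction to the special fibers. Then $u_{k'}$ is a universal homeomorphism. Its kernel, as a morphism of (additive) group schemes over $k'$, is pro-infinitesimal, that is, a cofiltered limit of infinitesimal group schemes over $k'$ (finite group schemes over $k'$ with only one point), and as a $k'$-scheme it is isomorphic to $$\mathrm{Spec}\Bigl(k'[X_0,X_1,\dots]\big/\bigl(X_i^{q^{i(r-1)}}\;:\;i\ge 0\bigr)\Bigr).$$ -/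

import Mathlib

universe u v

noncomputable section


namespace RamifiedWitt

/-! ### Witt polynomials and the integrality lemma -/

section Ghost

variable {B : Type*} [CommRing B]

/-- The value `b₀^(Q^n) + ϖ b₁^(Q^(n-1)) + ⋯ + ϖ^n bₙ` of the `n`-th Witt polynomial. -/
def ghost (ϖ : B) (Q n : ℕ) (b : ℕ → B) : B :=
  ∑ i ∈ Finset.range (n + 1), ϖ ^ i * b i ^ Q ^ (n - i)

lemma ghost_zero (ϖ : B) (Q : ℕ) (b : ℕ → B) : ghost ϖ Q 0 b = b 0 := by
  simp [ghost]

lemma ghost_succ (ϖ : B) (Q n : ℕ) (b : ℕ → B) :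
    ghost ϖ Q (n + 1) b = ghost ϖ Q n (fun i ↦ b i ^ Q) + ϖ ^ (n + 1) * b (n + 1) := by
  unfold ghost
  rw [Finset.sum_range_succ]
  congr 1
  · refine Finset.sum_congr rfl fun i hi ↦ ?_
    have : n + 1 - i = (n - i) + 1 := by
      have := Finset.mem_range.1 hi
      omega
    rw [this, pow_succ' Q, pow_mul]
  · simp

lemma map_ghost {B' : Type*} [CommRing B'] (f : B →+* B') (ϖ : B) (Q n : ℕ) (b : ℕ → B) :
    f (ghost ϖ Q n b) = ghost (f ϖ) Q n (fun i ↦ f (b i)) := by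
  simp [ghost]

lemma dvd_pow_sub_pow_step {ϖ : B} {Q : ℕ} (hQ : ϖ ∣ (Q : B)) {k : ℕ} {x y : B}
    (h : ϖ ^ (k + 1) ∣ x - y) : ϖ ^ (k + 2) ∣ x ^ Q - y ^ Q := by
  have h1 : ϖ ∣ x - y := (dvd_pow_self ϖ (Nat.succ_ne_zero k)).trans h
  rw [← (Commute.all x y).mul_geom_sum₂, pow_succ ϖ (k + 1)]
  refine mul_dvd_mul h ?_
  rw [← Ideal.Quotient.eq_zero_iff_dvd] at h1 hQ ⊢
  have e : Ideal.Quotient.mk (Ideal.span {ϖ}) x = Ideal.Quotient.mk _ y := by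
    simpa [sub_eq_zero] using h1
  simp only [map_sum, map_mul, map_pow, e]
  rw [geom_sum₂_self, ← map_natCast (Ideal.Quotient.mk (Ideal.span {ϖ})), hQ, zero_mul]

lemma dvd_pow_sub_pow {ϖ : B} {Q : ℕ} (hQ : ϖ ∣ (Q : B)) {x y : B}
    (h : ϖ ∣ x - y) (s : ℕ) : ϖ ^ (s + 1) ∣ x ^ Q ^ s - y ^ Q ^ s := by
  induction s with
  | zero => simpa using h
  | succ s ih =>
    rw [pow_succ Q, pow_mul, pow_mul]
    exact dvd_pow_sub_pow_step hQ ih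

lemma ghost_congr {ϖ : B} {Q : ℕ} (hQ : ϖ ∣ (Q : B)) {b c : ℕ → B}
    (h : ∀ i, ϖ ∣ b i - c i) (n : ℕ) : ϖ ^ (n + 1) ∣ ghost ϖ Q n b - ghost ϖ Q n c := by
  unfold ghost
  rw [← Finset.sum_sub_distrib]
  refine Finset.dvd_sum fun i hi ↦ ?_
  have hi' : i ≤ n := Nat.lt_succ_iff.1 (Finset.mem_range.1 hi)
  rw [← mul_sub, show n + 1 = i + ((n - i) + 1) by omega, pow_add]
  exact mul_dvd_mul_left _ (dvd_pow_sub_pow hQ (h i) _)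

/-- The recursive solution of `ghost ϖ Q n b = a n`, when it exists. -/
def solve (ϖ : B) (Q : ℕ) (a : ℕ → B) : ℕ → B
  | n =>
    open Classical in
    if h : ∃ x, a n = ∑ i : Fin n, ϖ ^ i.1 * (solve ϖ Q a i.1) ^ Q ^ (n - i.1) + ϖ ^ n * x
    then h.choose else 0
  termination_by n => n
  decreasing_by exact i.2

lemma ghost_solve {ϖ : B} {Q : ℕ} {a : ℕ → B} {n : ℕ}
    (h : ∃ x, a n = ∑ i ∈ Finset.range n, ϖ ^ i * (solve ϖ Q a i) ^ Q ^ (n - i) + ϖ ^ n * x) :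
    ghost ϖ Q n (solve ϖ Q a) = a n := by
  unfold ghost
  rw [Finset.sum_range_succ]
  rw [Finset.sum_range fun i ↦ ϖ ^ i * (solve ϖ Q a i) ^ Q ^ (n - i)] at h ⊢
  conv_lhs => enter [2, 2]; rw [solve]
  rw [dif_pos h]
  have := h.choose_spec
  simpa using this.symm

/-- Dwork's integrality lemma. -/
lemma ghost_solve_of_dvd {ϖ : B} {Q : ℕ} (hQ : ϖ ∣ (Q : B)) (σ : B →+* B) (hσ : σ ϖ = ϖ)
    (hσQ : ∀ b, ϖ ∣ σ b - b ^ Q) {a : ℕ → B} (ha : ∀ n, ϖ ^ (n + 1) ∣ σ (a n) - a (n + 1))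
    (n : ℕ) : ghost ϖ Q n (solve ϖ Q a) = a n := by
  induction n with
  | zero => exact ghost_solve ⟨a 0, by simp⟩
  | succ n ih =>
    apply ghost_solve
    have h1 : ϖ ^ (n + 1) ∣ a (n + 1) - ghost ϖ Q n (fun i ↦ solve ϖ Q a i ^ Q) := by
      have h2 := ghost_congr hQ (fun i ↦ hσQ (solve ϖ Q a i)) n
      have h3 := map_ghost σ ϖ Q n (solve ϖ Q a)
      rw [hσ, ih] at h3
      rw [← h3] at h2
      have := dvd_sub h2 (ha n)
      simpa using this
    obtain ⟨x, hx⟩ := h1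
    refine ⟨x, ?_⟩
    have h4 := ghost_succ ϖ Q n (solve ϖ Q a)
    unfold ghost at h4 hx
    rw [Finset.sum_range_succ] at h4
    simp only [tsub_self, pow_zero, pow_one, add_left_inj] at h4
    rw [h4, ← hx]
    ring

lemma ghost_injective {ϖ : B} (hϖ : IsLeftRegular ϖ) (Q : ℕ) {b c : ℕ → B}
    (h : ∀ n, ghost ϖ Q n b = ghost ϖ Q n c) : b = c := by
  funext n
  induction n using Nat.strong_induction_on with
  | _ n ih =>
    have h1 := h n
    unfold ghost at h1
    rw [Finset.sum_range_succ, Finset.sum_range_succ,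
      Finset.sum_congr rfl fun i hi ↦ by rw [ih i (Finset.mem_range.1 hi)]] at h1
    simpa using (hϖ.pow n) (by simpa using h1)

end Ghost

/-! ### Discrete valuation rings with finite residue field -/

section DVR

variable {O : Type u} [CommRing O] [IsDomain O] [IsDiscreteValuationRing O] {π : O}

variable (O) in
/-- The cardinality of the residue field. -/
abbrev resCard : ℕ := Nat.card (IsLocalRing.ResidueField O)

lemma dvd_iff_residue (hπ : Irreducible π) (a : O) : π ∣ a ↔ IsLocalRing.residue O a = 0 := by
  rw [IsLocalRing.residue_eq_zero_iff, hπ.maximalIdeal_eq, Ideal.mem_span_singleton]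

variable [Finite (IsLocalRing.ResidueField O)]

lemma dvd_resCard (hπ : Irreducible π) : π ∣ (resCard O : O) := by
  have := Fintype.ofFinite (IsLocalRing.ResidueField O)
  rw [dvd_iff_residue hπ, map_natCast, resCard, Nat.card_eq_fintype_card, Nat.cast_card_eq_zero]

lemma dvd_pow_resCard_sub (hπ : Irreducible π) (a : O) : π ∣ a ^ resCard O - a := by
  rw [dvd_iff_residue hπ, map_sub, map_pow]
  have := Fintype.ofFinite (IsLocalRing.ResidueField O)
  rw [resCard, Nat.card_eq_fintype_card, FiniteField.pow_card, sub_self]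

lemma exists_resCard_eq (hπ : Irreducible π) :
    ∃ p h : ℕ, p.Prime ∧ resCard O = p ^ h ∧ π ∣ (p : O) := by
  have := Fintype.ofFinite (IsLocalRing.ResidueField O)
  obtain ⟨p, hp⟩ := CharP.exists (IsLocalRing.ResidueField O)
  obtain ⟨n, h1, h2⟩ := FiniteField.card (IsLocalRing.ResidueField O) p
  refine ⟨p, n, h1, by rw [resCard, Nat.card_eq_fintype_card, h2], ?_⟩
  rw [dvd_iff_residue hπ, map_natCast, CharP.cast_eq_zero]

open MvPolynomial in
lemma dvd_expand_sub_pow (hπ : Irreducible π) {ι : Type*} (f : MvPolynomial ι O) :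
    (C π : MvPolynomial ι O) ∣ expand (resCard O) f - f ^ resCard O := by
  obtain ⟨p, h, hp, hq, hpp⟩ := exists_resCard_eq hπ
  have hp' : (C π : MvPolynomial ι O) ∣ (p : MvPolynomial ι O) := by
    rw [← map_natCast (C : O →+* MvPolynomial ι O)]
    exact map_dvd _ hpp
  induction f using MvPolynomial.induction_on with
  | C a =>
    rw [expand_C, ← map_pow, ← map_sub, ← dvd_neg, ← map_neg, neg_sub]
    exact map_dvd _ (dvd_pow_resCard_sub hπ a)
  | add f g hf hg =>
    obtain ⟨r, hr⟩ := exists_add_pow_prime_pow_eq hp f g h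
    rw [← hq] at hr
    rw [hr, map_add]
    have := dvd_sub (dvd_add hf hg) (hp'.mul_right (f * g * r))
    convert this using 1
    ring
  | mul_X f i hf =>
    rw [map_mul, expand_X, mul_pow, ← sub_mul]
    exact hf.mul_right _

open MvPolynomial in
/-- The integrality lemma in polynomial rings over `O`. -/
lemma ghost_solve_mvPolynomial (hπ : Irreducible π) {ι : Type*} {a : ℕ → MvPolynomial ι O}
    (ha : ∀ n, (C π : MvPolynomial ι O) ^ (n + 1) ∣ expand (resCard O) (a n) - a (n + 1)) (n : ℕ) :
    ghost (C π) (resCard O) n (solve (C π) (resCard O) a) = a n := by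
  have h1 : (C π : MvPolynomial ι O) ∣ (resCard O : MvPolynomial ι O) := by
    rw [← map_natCast (C : O →+* MvPolynomial ι O)]
    exact map_dvd _ (dvd_resCard hπ)
  exact ghost_solve_of_dvd h1 (expand (resCard O) : MvPolynomial ι O →ₐ[O] MvPolynomial ι O)
    (by simp) (fun b ↦ dvd_expand_sub_pow hπ b) ha n

end DVR

end RamifiedWitt

namespace RamifiedWitt

open MvPolynomial

variable {O : Type u} [CommRing O] [IsDomain O] [IsDiscreteValuationRing O] {π : O}

/-! ### Ramified Witt vectors -/

/-- Ramified Witt vectors over `O` with respect to the uniformizer `π` (and the cardinality of the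
residue field of `O`), with coefficients in `B`. -/
def WittVec (_hπ : Irreducible π) (B : Type v) : Type v := ℕ → B

variable (π) in
/-- The addition polynomials: the `n`-th Witt polynomial of `addPoly π` is the sum of the `n`-th
Witt polynomials of the two sets of variables. -/
def addPoly : ℕ → MvPolynomial (ℕ ⊕ ℕ) O :=
  solve (C π) (resCard O) fun n ↦
    ghost (C π) (resCard O) n (fun i ↦ X (Sum.inl i)) +
      ghost (C π) (resCard O) n (fun i ↦ X (Sum.inr i))

variable (π) in
/-- The multiplication polynomials. -/
def mulPoly : ℕ → MvPolynomial (ℕ ⊕ ℕ) O :=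
  solve (C π) (resCard O) fun n ↦
    ghost (C π) (resCard O) n (fun i ↦ X (Sum.inl i)) *
      ghost (C π) (resCard O) n (fun i ↦ X (Sum.inr i))

variable (π) in
/-- The negation polynomials. -/
def negPoly : ℕ → MvPolynomial ℕ O :=
  solve (C π) (resCard O) fun n ↦ - ghost (C π) (resCard O) n X

namespace WittVec

variable {hπ : Irreducible π} {B : Type*} [CommRing B] [Algebra O B]

instance : Zero (WittVec hπ B) := ⟨fun _ ↦ 0⟩

instance : One (WittVec hπ B) := ⟨fun n ↦ if n = 0 then 1 else 0⟩

instance : Add (WittVec hπ B) := ⟨fun a b n ↦ aeval (Sum.elim a b) (addPoly π n)⟩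

instance : Mul (WittVec hπ B) := ⟨fun a b n ↦ aeval (Sum.elim a b) (mulPoly π n)⟩

instance : Neg (WittVec hπ B) := ⟨fun a n ↦ aeval a (negPoly π n)⟩

/-- The ghost components. -/
def gh (n : ℕ) (a : WittVec hπ B) : B := ghost (algebraMap O B π) (resCard O) n a

/-- Functoriality in the ring of coefficients. -/
def mapFun {B' : Type*} (f : B → B') (a : WittVec hπ B) : WittVec hπ B' := fun n ↦ f (a n)

section map

variable {B' : Type*} [CommRing B'] [Algebra O B'] (f : B →ₐ[O] B')

lemma mapFun_add (a b : WittVec hπ B) : mapFun f (a + b) = mapFun f a + mapFun f b := by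
  funext n
  change f (aeval (Sum.elim a b) (addPoly π n)) =
    aeval (Sum.elim (mapFun f a) (mapFun f b)) (addPoly π n)
  rw [← AlgHom.comp_apply, comp_aeval]
  congr 2
  funext i
  cases i <;> rfl

lemma mapFun_mul (a b : WittVec hπ B) : mapFun f (a * b) = mapFun f a * mapFun f b := by
  funext n
  change f (aeval (Sum.elim a b) (mulPoly π n)) =
    aeval (Sum.elim (mapFun f a) (mapFun f b)) (mulPoly π n)
  rw [← AlgHom.comp_apply, comp_aeval]
  congr 2
  funext i
  cases i <;> rfl

lemma mapFun_neg (a : WittVec hπ B) : mapFun f (-a) = -mapFun f a := by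
  funext n
  exact AlgHom.congr_fun (comp_aeval (fun i ↦ a i) f) (negPoly π n)

lemma mapFun_zero : mapFun f (0 : WittVec hπ B) = 0 := by
  funext n
  exact map_zero f

lemma mapFun_one : mapFun f (1 : WittVec hπ B) = 1 := by
  funext n
  change f (if n = 0 then 1 else 0) = if n = 0 then 1 else 0
  split_ifs
  exacts [map_one f, map_zero f]

end map

lemma resCard_ne_zero [Finite (IsLocalRing.ResidueField O)] : resCard O ≠ 0 := Nat.card_pos.ne'

section ghost

variable [Finite (IsLocalRing.ResidueField O)]

lemma dvd_expand_ghost {ι : Type*} (j : ℕ → ι) (n : ℕ) :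
    (C π : MvPolynomial ι O) ^ (n + 1) ∣
      expand (resCard O) (ghost (C π) (resCard O) n (fun i ↦ X (j i))) -
      ghost (C π) (resCard O) (n + 1) (fun i ↦ X (j i)) := by
  have h := map_ghost (expand (resCard O) : MvPolynomial ι O →ₐ[O] MvPolynomial ι O).toRingHom
    (C π) (resCard O) n (fun i ↦ X (j i))
  simp only [AlgHom.toRingHom_eq_coe, RingHom.coe_coe, expand_C, expand_X] at h
  rw [h, ghost_succ, sub_add_cancel_left, dvd_neg]
  exact dvd_mul_right _ _

lemma ghost_addPoly (hπ : Irreducible π) (n : ℕ) : ghost (C π) (resCard O) n (addPoly π) =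
    ghost (C π) (resCard O) n (fun i ↦ X (Sum.inl i)) +
      ghost (C π) (resCard O) n (fun i ↦ X (Sum.inr i)) := by
  refine ghost_solve_mvPolynomial hπ (fun n ↦ ?_) n
  rw [map_add, add_sub_add_comm]
  exact dvd_add (dvd_expand_ghost _ n) (dvd_expand_ghost _ n)

lemma ghost_mulPoly (hπ : Irreducible π) (n : ℕ) : ghost (C π) (resCard O) n (mulPoly π) =
    ghost (C π) (resCard O) n (fun i ↦ X (Sum.inl i)) *
      ghost (C π) (resCard O) n (fun i ↦ X (Sum.inr i)) := by
  refine ghost_solve_mvPolynomial hπ (fun n ↦ ?_) n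
  rw [map_mul]
  exact dvd_mul_sub_mul (dvd_expand_ghost _ n) (dvd_expand_ghost _ n)

lemma ghost_negPoly (hπ : Irreducible π) (n : ℕ) : ghost (C π) (resCard O) n (negPoly π) =
    - ghost (C π) (resCard O) n X := by
  refine ghost_solve_mvPolynomial hπ (fun n ↦ ?_) n
  rw [map_neg, neg_sub_neg, ← dvd_neg, neg_sub]
  exact dvd_expand_ghost _ n

lemma aeval_ghost {ι : Type*} (v : ι → B) (n : ℕ) (b : ℕ → MvPolynomial ι O) :
    aeval v (ghost (C π) (resCard O) n b) =
      ghost (algebraMap O B π) (resCard O) n (fun i ↦ aeval v (b i)) := by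
  have := map_ghost (aeval v : MvPolynomial ι O →ₐ[O] B).toRingHom (C π) (resCard O) n b
  simpa using this

lemma gh_add (n : ℕ) (a b : WittVec hπ B) : gh n (a + b) = gh n a + gh n b := by
  have h := congrArg (aeval (Sum.elim (fun i ↦ a i) (fun i ↦ b i))) (ghost_addPoly hπ n)
  rw [map_add, aeval_ghost, aeval_ghost, aeval_ghost] at h
  simp only [aeval_X, Sum.elim_inl, Sum.elim_inr] at h
  exact h

lemma gh_mul (n : ℕ) (a b : WittVec hπ B) : gh n (a * b) = gh n a * gh n b := by
  have h := congrArg (aeval (Sum.elim (fun i ↦ a i) (fun i ↦ b i))) (ghost_mulPoly hπ n)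
  rw [map_mul, aeval_ghost, aeval_ghost, aeval_ghost] at h
  simp only [aeval_X, Sum.elim_inl, Sum.elim_inr] at h
  exact h

lemma gh_neg (n : ℕ) (a : WittVec hπ B) : gh n (-a) = - gh n a := by
  have h := congrArg (aeval (fun i ↦ a i)) (ghost_negPoly hπ n)
  rw [map_neg, aeval_ghost, aeval_ghost] at h
  simp only [aeval_X] at h
  exact h

lemma gh_zero (n : ℕ) : gh n (0 : WittVec hπ B) = 0 := by
  unfold gh ghost
  refine Finset.sum_eq_zero fun i _ ↦ ?_
  change (algebraMap O B π) ^ i * (0 : B) ^ (resCard O ^ (n - i)) = 0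
  rw [zero_pow (pow_ne_zero _ resCard_ne_zero), mul_zero]

lemma gh_one (n : ℕ) : gh n (1 : WittVec hπ B) = 1 := by
  change ∑ i ∈ Finset.range (n + 1), _ ^ i * (if i = 0 then (1 : B) else 0) ^ _ = 1
  rw [Finset.sum_eq_single 0]
  · simp
  · intro i _ hi
    rw [if_neg hi, zero_pow (pow_ne_zero _ resCard_ne_zero), mul_zero]
  · simp

variable (hπ) in
lemma gh_ext {ι : Type*} {a b : WittVec hπ (MvPolynomial ι O)} (h : ∀ n, gh n a = gh n b) :
    a = b :=
  ghost_injective (IsLeftCancelMulZero.mul_left_cancel_of_ne_zero (by simpa using hπ.ne_zero))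
    (resCard O) h

end ghost

lemma exists_mapFun_eq (a : WittVec hπ B) :
    ∃ a' : WittVec hπ (MvPolynomial B O), mapFun (aeval (R := O) (id : B → B)) a' = a :=
  ⟨fun n ↦ X (a n), funext fun n ↦ by simp [mapFun]⟩

instance [Finite (IsLocalRing.ResidueField O)] : CommRing (WittVec hπ B) :=
  CommRing.ofMinimalAxioms
    (fun a b c ↦ by
      obtain ⟨a, rfl⟩ := exists_mapFun_eq a
      obtain ⟨b, rfl⟩ := exists_mapFun_eq b
      obtain ⟨c, rfl⟩ := exists_mapFun_eq c
      simp only [← mapFun_add]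
      exact congrArg _ (gh_ext hπ fun n ↦ by simp only [gh_add]; ring))
    (fun a ↦ by
      obtain ⟨a, rfl⟩ := exists_mapFun_eq a
      rw [← mapFun_zero (aeval (R := O) (id : B → B)), ← mapFun_add]
      exact congrArg _ (gh_ext hπ fun n ↦ by simp only [gh_add, gh_zero]; ring))
    (fun a ↦ by
      obtain ⟨a, rfl⟩ := exists_mapFun_eq a
      rw [← mapFun_zero (aeval (R := O) (id : B → B)), ← mapFun_neg, ← mapFun_add]
      exact congrArg _ (gh_ext hπ fun n ↦ by simp only [gh_add, gh_neg, gh_zero]; ring))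
    (fun a b c ↦ by
      obtain ⟨a, rfl⟩ := exists_mapFun_eq a
      obtain ⟨b, rfl⟩ := exists_mapFun_eq b
      obtain ⟨c, rfl⟩ := exists_mapFun_eq c
      simp only [← mapFun_mul]
      exact congrArg _ (gh_ext hπ fun n ↦ by simp only [gh_mul]; ring))
    (fun a b ↦ by
      obtain ⟨a, rfl⟩ := exists_mapFun_eq a
      obtain ⟨b, rfl⟩ := exists_mapFun_eq b
      simp only [← mapFun_mul]
      exact congrArg _ (gh_ext hπ fun n ↦ by simp only [gh_mul]; ring))
    (fun a ↦ by
      obtain ⟨a, rfl⟩ := exists_mapFun_eq a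
      rw [← mapFun_one (aeval (R := O) (id : B → B)), ← mapFun_mul]
      exact congrArg _ (gh_ext hπ fun n ↦ by simp only [gh_mul, gh_one]; ring))
    (fun a b c ↦ by
      obtain ⟨a, rfl⟩ := exists_mapFun_eq a
      obtain ⟨b, rfl⟩ := exists_mapFun_eq b
      obtain ⟨c, rfl⟩ := exists_mapFun_eq c
      simp only [← mapFun_mul, ← mapFun_add]
      exact congrArg _ (gh_ext hπ fun n ↦ by simp only [gh_mul, gh_add]; ring))

variable [Finite (IsLocalRing.ResidueField O)]

/-- Functoriality in the ring of coefficients. -/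
def map {B' : Type*} [CommRing B'] [Algebra O B'] (f : B →ₐ[O] B') :
    WittVec hπ B →+* WittVec hπ B' where
  toFun := mapFun f
  map_zero' := mapFun_zero f
  map_one' := mapFun_one f
  map_add' := mapFun_add f
  map_mul' := mapFun_mul f

end WittVec

/-! ### Drinfeld's map -/

section Drinfeld

variable {O' : Type u} [CommRing O'] [IsDomain O'] [IsDiscreteValuationRing O'] [Algebra O O']
  {ϖ : O'}

variable (π ϖ) in
/-- The components of Drinfeld's morphism: polynomials over `O'` whose `n`-th Witt polynomial with
respect to `O'` is the `r n`-th Witt polynomial of the variables with respect to `O`. -/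
def drinfeldPoly (r : ℕ) : ℕ → MvPolynomial ℕ O' :=
  solve (C ϖ) (resCard O') fun n ↦ ghost (C (algebraMap O O' π)) (resCard O) (r * n) X

lemma dvd_ghost_sub {B : Type*} [CommRing B] (π : B) (Q n s : ℕ) (b : ℕ → B) :
    π ^ (n + 1) ∣ ghost π Q n (fun i ↦ b i ^ Q ^ s) - ghost π Q (n + s) b := by
  induction s generalizing b with
  | zero => simp
  | succ s ih =>
    have h := ih (fun i ↦ b i ^ Q)
    simp only [← pow_mul, ← pow_succ'] at h
    rw [← add_assoc, ghost_succ, ← sub_sub]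
    exact dvd_sub h ((pow_dvd_pow _ (by omega)).mul_right _)

variable [Finite (IsLocalRing.ResidueField O)] [Finite (IsLocalRing.ResidueField O')]

lemma ne_zero_of_resCard_eq {r : ℕ} (hr : resCard O' = resCard O ^ r) : r ≠ 0 := by
  rintro rfl
  have : 1 < resCard O' := Finite.one_lt_card
  rw [hr, pow_zero] at this
  exact lt_irrefl _ this

lemma ghost_drinfeldPoly [Module.Finite O O'] [FaithfulSMul O O']
    (hπ : Irreducible π) (hϖ : Irreducible ϖ) {r : ℕ} (hr : resCard O' = resCard O ^ r) (n : ℕ) :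
    ghost (C ϖ) (resCard O') n (drinfeldPoly π ϖ r) =
      ghost (C (algebraMap O O' π)) (resCard O) (r * n) X := by
  refine ghost_solve_mvPolynomial hϖ (fun n ↦ ?_) n
  have h := map_ghost
    (expand (resCard O') : MvPolynomial ℕ O' →ₐ[O'] MvPolynomial ℕ O').toRingHom
    (C (algebraMap O O' π)) (resCard O) (r * n) X
  simp only [AlgHom.toRingHom_eq_coe, RingHom.coe_coe, expand_C, expand_X] at h
  rw [h, hr, mul_add, mul_one]
  refine dvd_trans ?_ (dvd_ghost_sub (C (algebraMap O O' π)) (resCard O) (r * n) r X)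
  have h1 : ϖ ∣ algebraMap O O' π := by
    rw [← Ideal.mem_span_singleton, ← hϖ.maximalIdeal_eq, IsLocalRing.mem_maximalIdeal]
    exact fun h ↦ hπ.not_isUnit (isUnit_of_map_unit (algebraMap O O') π h)
  refine (pow_dvd_pow_of_dvd (map_dvd C h1) _).trans (pow_dvd_pow _ ?_)
  have := Nat.le_mul_of_pos_left n (Nat.pos_of_ne_zero (ne_zero_of_resCard_eq hr))
  omega

namespace WittVec

variable [Module.Finite O O'] [FaithfulSMul O O'] {hπ : Irreducible π} {hϖ : Irreducible ϖ}
  {B : Type*} [CommRing B] [Algebra O B] [Algebra O' B]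

/-- Drinfeld's map on coefficients. -/
def drinfeldFun (hϖ : Irreducible ϖ) (r : ℕ) (a : WittVec hπ B) : WittVec hϖ B :=
  fun n ↦ aeval (fun i ↦ a i) (drinfeldPoly π ϖ r n)

lemma mapFun_drinfeldFun (r : ℕ) {B' : Type*} [CommRing B'] [Algebra O' B'] (f : B →ₐ[O'] B')
    (a : WittVec hπ B) : mapFun f (drinfeldFun hϖ r a) = drinfeldFun hϖ r (mapFun f a) := by
  funext n
  exact AlgHom.congr_fun (comp_aeval (fun i ↦ a i) f) (drinfeldPoly π ϖ r n)

lemma gh_drinfeldFun [IsScalarTower O O' B] {r : ℕ} (hr : resCard O' = resCard O ^ r) (n : ℕ)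
    (a : WittVec hπ B) : gh n (drinfeldFun hϖ r a) = gh (r * n) a := by
  have h := congrArg (aeval (fun i ↦ a i)) (ghost_drinfeldPoly hπ hϖ hr n)
  rw [aeval_ghost] at h
  have h2 := map_ghost (aeval (fun i ↦ a i) : MvPolynomial ℕ O' →ₐ[O'] B).toRingHom
    (C (algebraMap O O' π)) (resCard O) (r * n) X
  simp only [AlgHom.toRingHom_eq_coe, RingHom.coe_coe, aeval_C, aeval_X,
    ← IsScalarTower.algebraMap_apply O O' B] at h2
  exact h.trans h2

/-- Every ring of Witt vectors is a quotient of one with coefficients in a polynomial ring. -/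
lemma exists_mapFun_eq' (a : WittVec hπ B) :
    ∃ a' : WittVec hπ (MvPolynomial B O'), mapFun (aeval (R := O') (id : B → B)) a' = a :=
  ⟨fun n ↦ X (a n), funext fun n ↦ by simp [mapFun]⟩

variable [IsScalarTower O O' B]

/-- Drinfeld's map, as a homomorphism of rings. -/
def drinfeldMap (hπ : Irreducible π) (hϖ : Irreducible ϖ) {r : ℕ}
    (hr : resCard O' = resCard O ^ r) : WittVec hπ B →+* WittVec hϖ B where
  toFun := drinfeldFun hϖ r
  map_zero' := by
    rw [← mapFun_zero ((aeval (R := O') (id : B → B)).restrictScalars O),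
      ← mapFun_zero (aeval (R := O') (id : B → B))]
    refine (mapFun_drinfeldFun r (aeval (R := O') (id : B → B)) _).symm.trans ?_
    exact congrArg _ (gh_ext hϖ fun n ↦ by simp only [gh_drinfeldFun hr, gh_zero])
  map_one' := by
    rw [← mapFun_one ((aeval (R := O') (id : B → B)).restrictScalars O),
      ← mapFun_one (aeval (R := O') (id : B → B))]
    refine (mapFun_drinfeldFun r (aeval (R := O') (id : B → B)) _).symm.trans ?_
    exact congrArg _ (gh_ext hϖ fun n ↦ by simp only [gh_drinfeldFun hr, gh_one])
  map_add' a b := by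
    obtain ⟨a, rfl⟩ := exists_mapFun_eq' (O' := O') a
    obtain ⟨b, rfl⟩ := exists_mapFun_eq' (O' := O') b
    rw [← mapFun_drinfeldFun, ← mapFun_drinfeldFun, ← mapFun_add]
    refine (congrArg _ (mapFun_add ((aeval (R := O') (id : B → B)).restrictScalars O) a b).symm
      |>.trans (mapFun_drinfeldFun r (aeval (R := O') (id : B → B)) _).symm).trans ?_
    exact congrArg _ (gh_ext hϖ fun n ↦ by simp only [gh_drinfeldFun hr, gh_add])
  map_mul' a b := by
    obtain ⟨a, rfl⟩ := exists_mapFun_eq' (O' := O') a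
    obtain ⟨b, rfl⟩ := exists_mapFun_eq' (O' := O') b
    rw [← mapFun_drinfeldFun, ← mapFun_drinfeldFun, ← mapFun_mul]
    refine (congrArg _ (mapFun_mul ((aeval (R := O') (id : B → B)).restrictScalars O) a b).symm
      |>.trans (mapFun_drinfeldFun r (aeval (R := O') (id : B → B)) _).symm).trans ?_
    exact congrArg _ (gh_ext hϖ fun n ↦ by simp only [gh_drinfeldFun hr, gh_mul])

end WittVec

end Drinfeld

end RamifiedWitt

namespace RamifiedWitt

open MvPolynomial AlgebraicGeometry CategoryTheory Limits Opposite

/-! ### Ramified Witt vectors as a group scheme -/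

section Scheme

/-- The scheme `Spec R[X₀, X₁, …]` over `Spec R`. -/
abbrev affineSpace (R : Type u) [CommRing R] : Over (Spec (.of R)) :=
  Over.mk (Spec.map (CommRingCat.ofHom (C : R →+* MvPolynomial ℕ R)))

/-- The `R`-algebra of global sections of a scheme over `Spec R`. -/
abbrev sections {R : Type u} [CommRing R] (T : Over (Spec (.of R))) : CommAlgCat R :=
  ((algΓ (.of R)).obj T).unop

lemma algebraMap_sections {R : Type u} [CommRing R] (T : Over (Spec (.of R))) (x : R) :
    algebraMap R (sections T) x = T.hom.appTop ((Scheme.ΓSpecIso (.of R)).inv x) := rfl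

lemma eq_toSpecΓ_comp {X : Scheme.{u}} {A : CommRingCat.{u}} (f : X ⟶ Spec A) :
    f = X.toSpecΓ ≫ Spec.map ((Scheme.ΓSpecIso A).inv ≫ f.appTop) := by
  rw [Spec.map_comp, ← Scheme.toSpecΓ_naturality_assoc, toSpecΓ_SpecMap_ΓSpecIso_inv,
    Category.comp_id]

lemma ΓSpecIso_inv_comp_appTop {X : Scheme.{u}} {A A' : CommRingCat.{u}} (φ : A ⟶ A')
    (f : X ⟶ Spec A') (g : X ⟶ Spec A) (h : f ≫ Spec.map φ = g) :
    (Scheme.ΓSpecIso A).inv ≫ g.appTop = φ ≫ (Scheme.ΓSpecIso A').inv ≫ f.appTop := by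
  rw [Scheme.ΓSpecIso_inv_naturality_assoc, ← Scheme.Hom.comp_appTop, h]

variable {R : Type u} [CommRing R]

/-- Morphisms to `Spec R[X₀, X₁, …]` are sequences of global sections. -/
def homEquiv (T : Over (Spec (.of R))) : (T ⟶ affineSpace R) ≃ (ℕ → sections T) where
  toFun f i := f.left.appTop ((Scheme.ΓSpecIso (.of (MvPolynomial ℕ R))).inv (X i))
  invFun v := Over.homMk (T.left.toSpecΓ ≫
    Spec.map (CommRingCat.ofHom (aeval v : MvPolynomial ℕ R →ₐ[R] sections T).toRingHom)) <| by
      refine Eq.trans ?_ (eq_toSpecΓ_comp T.hom).symm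
      simp only [affineSpace, Over.mk_hom, Category.assoc, ← Spec.map_comp]
      congr 2
      ext x
      exact (aeval v : MvPolynomial ℕ R →ₐ[R] sections T).commutes x
  left_inv f := by
    ext1
    refine Eq.trans ?_ (eq_toSpecΓ_comp f.left).symm
    simp only [Over.homMk_left]
    congr 2
    refine CommRingCat.hom_ext (MvPolynomial.ringHom_ext (fun x ↦ ?_) fun i ↦ ?_)
    · refine (aeval_C (S₁ := sections T) _ x).trans ?_
      exact ConcreteCategory.congr_hom (ΓSpecIso_inv_comp_appTop (CommRingCat.ofHom C) f.left T.hom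
        (Over.w f)) x
    · exact aeval_X (S₁ := sections T) _ i
  right_inv v := by
    funext i
    have h : (Scheme.ΓSpecIso (.of (MvPolynomial ℕ R))).inv ≫ (T.left.toSpecΓ ≫
        Spec.map (CommRingCat.ofHom
          (aeval v : MvPolynomial ℕ R →ₐ[R] sections T).toRingHom)).appTop =
        CommRingCat.ofHom (aeval v : MvPolynomial ℕ R →ₐ[R] sections T).toRingHom := by
      simp
      rfl
    exact (ConcreteCategory.congr_hom h (X i)).trans (aeval_X (S₁ := sections T) _ i)

lemma homEquiv_comp {S T : Over (Spec (.of R))} (g : S ⟶ T) (f : T ⟶ affineSpace R) (i : ℕ) :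
    homEquiv S (g ≫ f) i = ((algΓ (.of R)).map g).unop.hom (homEquiv T f i) := by
  simp [homEquiv]
  rfl

variable {O : Type u} [CommRing O] [IsDomain O] [IsDiscreteValuationRing O]
  [Finite (IsLocalRing.ResidueField O)] {π : O}

/-- The ring of ramified Witt vectors as a functor on `O`-algebras. -/
def wittFunctor (hπ : Irreducible π) : CommAlgCat.{u} O ⥤ CommRingCat.{u} where
  obj B := .of (WittVec hπ B)
  map f := CommRingCat.ofHom (WittVec.map f.hom)

/-- The ring of ramified Witt vectors of the global sections, as a presheaf of rings on schemes
over `Spec O`. -/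
def wittPresheaf (hπ : Irreducible π) : (Over (Spec (.of O)))ᵒᵖ ⥤ CommRingCat.{u} :=
  (algΓ (.of O)).leftOp ⋙ wittFunctor hπ

/-- `Spec O[X₀, X₁, …]` represents the presheaf of rings `wittPresheaf`. -/
def wittRepresentableBy (hπ : Irreducible π) :
    (wittPresheaf hπ ⋙ forget CommRingCat).RepresentableBy (affineSpace O) where
  homEquiv {T} := homEquiv T
  homEquiv_comp g f := funext fun i ↦ homEquiv_comp g f i

/-- The additive groups underlying `wittPresheaf`, written multiplicatively. -/
def wittGrpPresheaf (hπ : Irreducible π) : (Over (Spec (.of O)))ᵒᵖ ⥤ GrpCat.{u} :=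
  wittPresheaf hπ ⋙ forget₂ CommRingCat RingCat ⋙ forget₂ RingCat AddCommGrpCat ⋙
    forget₂ AddCommGrpCat AddGrpCat ⋙ AddGrpCat.toGrp

/-- `Spec O[X₀, X₁, …]` represents the presheaf of groups `wittGrpPresheaf`. -/
def wittGrpRepresentableBy (hπ : Irreducible π) :
    (wittGrpPresheaf hπ ⋙ forget GrpCat).RepresentableBy (affineSpace O) where
  homEquiv {T} := homEquiv T
  homEquiv_comp g f := funext fun i ↦ homEquiv_comp g f i

/-- The scheme of ramified Witt vectors over `Spec O`, as a (commutative) group scheme. -/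
def wittScheme (hπ : Irreducible π) : Grp (Over (Spec (.of O))) where
  X := affineSpace O
  grp := GrpObj.ofRepresentableBy _ _ (wittGrpRepresentableBy hπ)

end Scheme

end RamifiedWitt

namespace RamifiedWitt

open MvPolynomial AlgebraicGeometry CategoryTheory Limits Opposite MonoidalCategory
  CartesianMonoidalCategory MonObj

section BaseChange

open scoped Obj

variable {S S' : Scheme.{u}} {b : S' ⟶ S}

/-- Morphisms of `S'`-schemes to a base change are morphisms of `S`-schemes. -/
def toBase {Y : Over S} {T : Over S'} (f : T ⟶ (Over.pullback b).obj Y) : (Over.map b).obj T ⟶ Y :=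
  Over.homMk (f.left ≫ pullback.fst Y.hom b) <| by
    have := Over.w f
    simp only [Over.pullback_obj_hom] at this
    simp [pullback.condition, reassoc_of% this]

lemma toBase_mul {Y : Over S} [GrpObj Y] {T : Over S'} (f g : T ⟶ (Over.pullback b).obj Y) :
    toBase (f * g) = toBase f * toBase g := by
  ext1
  have lift_left_fst {Z : Scheme.{u}} {A B X : Over Z} (f : A ⟶ B) (g : A ⟶ X) :
      (lift f g).left ≫ pullback.fst B.hom X.hom = f.left := congrArg (·.left) (lift_fst f g)
  have lift_left_snd {Z : Scheme.{u}} {A B X : Over Z} (f : A ⟶ B) (g : A ⟶ X) :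
      (lift f g).left ≫ pullback.snd B.hom X.hom = g.left := congrArg (·.left) (lift_snd f g)
  have h : (lift f g).left ≫ (Functor.LaxMonoidal.μ (Over.pullback b) Y Y).left ≫
      pullback.fst _ _ = (lift (toBase f) (toBase g)).left := by
    refine pullback.hom_ext ?_ ?_
    · simp only [Category.assoc, Over.μ_pullback_left_fst_fst]
      rw [← Category.assoc, lift_left_fst, lift_left_fst]
      rfl
    · simp only [Category.assoc, Over.μ_pullback_left_fst_snd]
      rw [← Category.assoc, lift_left_snd, lift_left_snd]
      rfl
  have h2 : ((Over.pullback b).map μ[Y]).left ≫ pullback.fst Y.hom b =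
      pullback.fst _ _ ≫ μ[Y].left := pullback.lift_fst _ _ _
  rw [Hom.mul_def (toBase f), Over.comp_left, ← h]
  simp only [Hom.mul_def, Over.comp_left, toBase, Over.homMk_left, Functor.obj.μ_def,
    Category.assoc, h2]

lemma isMonHom_of_map_mul {C : Type*} [Category C] [CartesianMonoidalCategory C] {G H : C}
    [GrpObj G] [GrpObj H] (u : G ⟶ H)
    (hu : ∀ (T : C) (f g : T ⟶ G), (f * g) ≫ u = (f ≫ u) * (g ≫ u)) : IsMonHom u where
  one_hom := by
    have h := hu _ (η[G]) (η[G])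
    rw [one_eq_one, _root_.one_mul] at h
    rw [one_eq_one, one_eq_one]
    exact left_eq_mul.mp h
  mul_hom := by
    have h := hu _ (fst G G) (snd G G)
    simp only [Hom.mul_def, lift_fst_snd, Category.id_comp] at h
    rw [h]
    congr 1
    ext <;> simp

end BaseChange

end RamifiedWitt

namespace RamifiedWitt

open MvPolynomial AlgebraicGeometry CategoryTheory Limits Opposite MonoidalCategory
  CartesianMonoidalCategory MonObj

section DrinfeldMorphism

variable (O : Type u) [CommRing O] (O' : Type u) [CommRing O'] [Algebra O O']

/-- The structure morphism `Spec O' ⟶ Spec O`. -/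
abbrev baseMap : Spec (.of O') ⟶ Spec (.of O) := Spec.map (CommRingCat.ofHom (algebraMap O O'))

variable {O O'}

/-- A morphism of `Spec O'`-schemes to the base change of `Spec O[X₀, X₁, …]`, as a sequence of
global sections. -/
def coords {T : Over (Spec (.of O'))} (f : T ⟶ (Over.pullback (baseMap O O')).obj (affineSpace O)) :
    ℕ → sections T :=
  homEquiv ((Over.map (baseMap O O')).obj T) (toBase f)

lemma coords_comp {S T : Over (Spec (.of O'))} (g : S ⟶ T)
    (f : T ⟶ (Over.pullback (baseMap O O')).obj (affineSpace O)) (i : ℕ) :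
    coords (g ≫ f) i = ((algΓ (.of O')).map g).unop.hom (coords f i) := by
  refine Eq.trans ?_ (homEquiv_comp ((Over.map (baseMap O O')).map g) (toBase f) i)
  have : toBase (g ≫ f) = (Over.map (baseMap O O')).map g ≫ toBase f := by
    ext1
    simp [toBase]
  rw [coords, this]

variable [IsDomain O] [IsDiscreteValuationRing O] [IsDomain O'] [IsDiscreteValuationRing O']

variable (O O') in
/-- Drinfeld's morphism, as a morphism of schemes over `Spec O'`: in coordinates it is given by the
polynomials `drinfeldPoly`. -/
def drinfeldHom (π : O) (ϖ : O') (r : ℕ) :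
    (Over.pullback (baseMap O O')).obj (affineSpace O) ⟶ affineSpace O' :=
  (homEquiv _).symm fun n ↦ aeval (coords (𝟙 _)) (drinfeldPoly π ϖ r n)

variable {π : O} {ϖ : O'}

lemma homEquiv_comp_drinfeldHom (r : ℕ) {T : Over (Spec (.of O'))}
    (f : T ⟶ (Over.pullback (baseMap O O')).obj (affineSpace O)) :
    homEquiv T (f ≫ drinfeldHom O O' π ϖ r) = fun n ↦ aeval (coords f) (drinfeldPoly π ϖ r n) := by
  funext n
  rw [homEquiv_comp, drinfeldHom, Equiv.apply_symm_apply, ← AlgHom.comp_apply, comp_aeval]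
  have h : (fun i ↦ ((algΓ (.of O')).map f).unop.hom (coords (𝟙 _) i)) = coords f :=
    funext fun i ↦ (coords_comp f (𝟙 _) i).symm.trans (by rw [Category.comp_id])
  rw [← h]

variable [Finite (IsLocalRing.ResidueField O)] [Finite (IsLocalRing.ResidueField O')]

/-- Sections of the scheme of ramified Witt vectors are ramified Witt vectors. -/
def wittEquiv (hπ : Irreducible π) (T : Over (Spec (.of O))) :
    (T ⟶ (wittScheme hπ).X) ≃ WittVec hπ (sections T) := homEquiv T

lemma wittEquiv_mul (hπ : Irreducible π) {T : Over (Spec (.of O))} (f g : T ⟶ (wittScheme hπ).X) :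
    wittEquiv hπ T (f * g) = wittEquiv hπ T f + wittEquiv hπ T g :=
  ((yonedaGrpObjIsoOfRepresentableBy _ _ (wittGrpRepresentableBy hπ)).hom.app (op T)).hom.map_mul
    f g

variable [Module.Finite O O'] [FaithfulSMul O O']

lemma drinfeldHom_mul (hπ : Irreducible π) (hϖ : Irreducible ϖ) {r : ℕ}
    (hr : resCard O' = resCard O ^ r) {T : Over (Spec (.of O'))}
    (f g : T ⟶ ((Over.pullback (baseMap O O')).mapGrp.obj (wittScheme hπ)).X)
    (u : ((Over.pullback (baseMap O O')).mapGrp.obj (wittScheme hπ)).X ⟶ (wittScheme hϖ).X)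
    (hu : u = drinfeldHom O O' π ϖ r) :
    (f * g) ≫ u = (f ≫ u) * (g ≫ u) := by
  let : Algebra O (sections T) :=
    inferInstanceAs (Algebra O (sections ((Over.map (baseMap O O')).obj T)))
  have : IsScalarTower O O' (sections T) := IsScalarTower.of_algebraMap_eq fun x ↦
    ConcreteCategory.congr_hom (ΓSpecIso_inv_comp_appTop (CommRingCat.ofHom (algebraMap O O'))
      T.hom ((Over.map (baseMap O O')).obj T).hom rfl) x
  let c (f : T ⟶ ((Over.pullback (baseMap O O')).mapGrp.obj (wittScheme hπ)).X) :
    WittVec hπ (sections T) := coords f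
  have hc : c (f * g) = c f + c g :=
    (congrArg (wittEquiv hπ ((Over.map (baseMap O O')).obj T)) (toBase_mul f g)).trans
      (wittEquiv_mul hπ _ _)
  have key (f) : wittEquiv hϖ T (f ≫ u) = WittVec.drinfeldMap hπ hϖ hr (c f) := by
    rw [hu]
    exact homEquiv_comp_drinfeldHom r f
  apply (wittEquiv hϖ T).injective
  rw [wittEquiv_mul, key, key, key, hc, map_add]

/-- Drinfeld's morphism, as a morphism of group schemes over `Spec O'` from the base change of the
scheme of ramified Witt vectors over `O` to the scheme of ramified Witt vectors over `O'`. -/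
def drinfeld (hπ : Irreducible π) (hϖ : Irreducible ϖ) {r : ℕ}
    (hr : resCard O' = resCard O ^ r) :
    (Over.pullback (baseMap O O')).mapGrp.obj (wittScheme hπ) ⟶ wittScheme hϖ :=
  let u : ((Over.pullback (baseMap O O')).mapGrp.obj (wittScheme hπ)).X ⟶ (wittScheme hϖ).X :=
    drinfeldHom O O' π ϖ r
  have : IsMonHom u := isMonHom_of_map_mul u fun _ f g ↦ drinfeldHom_mul hπ hϖ hr f g u rfl
  Grp.homMk u

/-- The restriction of Drinfeld's morphism to the special fibers: its base change to the residue
field of `O'`. -/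
def drinfeldSpecialFiber (hπ : Irreducible π) (hϖ : Irreducible ϖ) {r : ℕ}
    (hr : resCard O' = resCard O ^ r) :
    (Over.pullback (baseMap O' (IsLocalRing.ResidueField O'))).mapGrp.obj
        ((Over.pullback (baseMap O O')).mapGrp.obj (wittScheme hπ)) ⟶
      (Over.pullback (baseMap O' (IsLocalRing.ResidueField O'))).mapGrp.obj (wittScheme hϖ) :=
  (Over.pullback (baseMap O' (IsLocalRing.ResidueField O'))).mapGrp.map (drinfeld hπ hϖ hr)

end DrinfeldMorphism

/-! ### Universal homeomorphisms and pro-infinitesimal group schemes -/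

/-- A morphism of schemes all of whose base changes are homeomorphisms. -/
def IsUniversalHomeomorphism {X Y : Scheme.{u}} (f : X ⟶ Y) : Prop :=
  MorphismProperty.universally (topologically (IsHomeomorph ·)) f

/-- A group scheme over a field is infinitesimal if it is finite and has only one point (which is
then the image of the unit section). -/
def IsInfinitesimal {k : Type u} [Field k] (G : Grp (Over (Spec (.of k)))) : Prop :=
  IsFinite G.X.hom ∧ Subsingleton G.X.left

/-- A group scheme over a field is pro-infinitesimal if it is the limit of a cofiltered system of
infinitesimal group schemes. -/
def IsProInfinitesimal {k : Type u} [Field k] (G : Grp (Over (Spec (.of k)))) : Prop :=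
  ∃ (J : Type u) (_ : SmallCategory J) (_ : IsCofiltered J)
    (F : J ⥤ Grp (Over (Spec (.of k)))) (c : Cone F),
    (∀ j, IsInfinitesimal (F.obj j)) ∧ Nonempty (IsLimit c) ∧ Nonempty (c.pt ≅ G)

end RamifiedWitt

end

/-!
Since `O'` is unramified over `O`, the uniformizer `π` of `O` is also one of `O'`. Comparing Witt
polynomials modulo the powers of `ϖ` shows that, modulo `ϖ`, Drinfeld's morphism is
`Xₙ ↦ Xₙ ^ q ^ (n * (r - 1))` followed by the change of uniformizer from `π` to `ϖ`, which is an
automorphism fixing the origin. So on special fibers it is given by an injective ring homomorphism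
whose image contains a `p`-power of every element, hence it is a universal homeomorphism, and its
kernel is the locus `aₙ ^ q ^ (n * (r - 1)) = 0` of the scheme of Witt vectors.

The `n`-th coordinate of a sum of Witt vectors depends only on the coordinates of index at most `n`
of the summands, so forgetting all but the first `N` coordinates of the kernel gives a quotient
group. Setting the forgotten coordinates to `0` is a section, so this quotient is already a quotient
of presheaves, represented by the first `N` coordinates. It is finite with one point, and the kernel
is the inverse limit of these quotients.
-/

noncomputable section

namespace RamifiedWitt

open MvPolynomial

/-! ### Comparison of Witt polynomials -/

section Ghost

section CommRing

variable {B : Type*} [CommRing B] {ϖ : B} {Q : ℕ}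

lemma ghost_zero_right (ϖ : B) (hQ : Q ≠ 0) (n : ℕ) : ghost ϖ Q n 0 = 0 :=
  Finset.sum_eq_zero fun i _ ↦ by simp [zero_pow (pow_ne_zero _ hQ)]

lemma dvd_sub_of_pow_dvd_ghost_sub (hϖ : IsLeftRegular ϖ) (hQ : ϖ ∣ (Q : B)) {b c : ℕ → B}
    (h : ∀ n, ϖ ^ (n + 1) ∣ ghost ϖ Q n b - ghost ϖ Q n c) (n : ℕ) : ϖ ∣ b n - c n := by
  induction n using Nat.strong_induction_on with
  | _ n ih =>
    have lower : ϖ ^ (n + 1) ∣ ∑ i ∈ Finset.range n,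
        ϖ ^ i * (b i ^ Q ^ (n - i) - c i ^ Q ^ (n - i)) := by
      refine Finset.dvd_sum fun i hi ↦ ?_
      have hi := Finset.mem_range.1 hi
      rw [show n + 1 = i + ((n - i) + 1) by omega, pow_add]
      exact mul_dvd_mul_left _ (dvd_pow_sub_pow hQ (ih i hi) _)
    have top : ghost ϖ Q n b - ghost ϖ Q n c = ∑ i ∈ Finset.range n,
        ϖ ^ i * (b i ^ Q ^ (n - i) - c i ^ Q ^ (n - i)) + ϖ ^ n * (b n - c n) := by
      simp only [ghost, mul_sub, Finset.sum_sub_distrib, Finset.sum_range_succ, tsub_self,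
        pow_zero, pow_one]
      ring
    obtain ⟨d, hd⟩ := (dvd_add_right lower).1 (top ▸ h n)
    exact ⟨d, hϖ.pow n (by simpa only [pow_succ, mul_assoc] using hd)⟩

lemma pow_dvd_ghost_mul_sub_ghost_pow (ϖ : B) (q : ℕ) {r : ℕ} (hr : r ≠ 0) (x : ℕ → B) (n : ℕ) :
    ϖ ^ (n + 1) ∣ ghost ϖ q (r * n) x - ghost ϖ (q ^ r) n (fun i ↦ x i ^ q ^ (i * (r - 1))) := by
  have exponent {i : ℕ} (hi : i < n + 1) : i * (r - 1) + r * (n - i) = r * n - i := by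
    obtain ⟨s, rfl⟩ := Nat.exists_eq_succ_of_ne_zero hr
    obtain ⟨d, rfl⟩ := Nat.exists_eq_add_of_le (Nat.lt_succ_iff.1 hi)
    simp only [Nat.succ_eq_add_one, add_tsub_cancel_right, add_tsub_cancel_left]
    exact (Nat.sub_eq_of_eq_add (by ring)).symm
  have low_terms : ghost ϖ (q ^ r) n (fun i ↦ x i ^ q ^ (i * (r - 1))) =
      ∑ i ∈ Finset.range (n + 1), ϖ ^ i * x i ^ q ^ (r * n - i) :=
    Finset.sum_congr rfl fun i hi ↦ by
      rw [← pow_mul, ← pow_mul, ← pow_add, exponent (Finset.mem_range.1 hi)]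
  have hn : n + 1 ≤ r * n + 1 :=
    Nat.succ_le_succ (Nat.le_mul_of_pos_left n (Nat.pos_of_ne_zero hr))
  rw [low_terms, ghost, ← Finset.sum_range_add_sum_Ico _ hn, add_sub_cancel_left]
  exact Finset.dvd_sum fun i hi ↦ (pow_dvd_pow _ (Finset.mem_Ico.1 hi).1).mul_right _

end CommRing

variable {R ι : Type*} [CommRing R]

lemma aeval_ghost_C {S : Type*} [CommRing S] [Algebra R S] (ϖ : R) (Q n : ℕ) (v : ι → S)
    (b : ℕ → MvPolynomial ι R) :
    aeval v (ghost (C ϖ) Q n b) = ghost (algebraMap R S ϖ) Q n (fun i ↦ aeval v (b i)) := by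
  simpa using map_ghost (aeval v : MvPolynomial ι R →ₐ[R] S).toRingHom (C ϖ) Q n b

variable [IsDomain R] {ϖ : R}

lemma isLeftRegular_C (hϖ : ϖ ≠ 0) : IsLeftRegular (C ϖ : MvPolynomial ι R) :=
  IsLeftCancelMulZero.mul_left_cancel_of_ne_zero (by simpa using hϖ)

lemma mem_supported_of_ghost_mem_supported (hϖ : ϖ ≠ 0) (Q : ℕ) {s : Set ι}
    {b : ℕ → MvPolynomial ι R} {m : ℕ} (h : ∀ n ≤ m, ghost (C ϖ) Q n b ∈ supported R s) :
    b m ∈ supported R s := by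
  induction m using Nat.strong_induction_on with
  | _ m ih =>
    have lower : ∑ i ∈ Finset.range m, C ϖ ^ i * b i ^ Q ^ (m - i) ∈ supported R s := by
      refine sum_mem fun i hi ↦ mul_mem (pow_mem (algebraMap_mem _ ϖ) _) (pow_mem ?_ _)
      have hi := Finset.mem_range.1 hi
      exact ih i hi fun n hn ↦ h n (hn.trans hi.le)
    have top := h m le_rfl
    rw [ghost, Finset.sum_range_succ, add_mem_cancel_left lower, tsub_self, pow_zero, pow_one,
      ← C_pow, mem_supported, vars_C_mul _ (pow_ne_zero m hϖ)] at top
    exact mem_supported.2 top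

end Ghost

section AddPoly

variable {O : Type u} [CommRing O] [IsDomain O] [IsDiscreteValuationRing O]
  [Finite (IsLocalRing.ResidueField O)] {π : O}

lemma addPoly_mem_supported (hπ : Irreducible π) (n : ℕ) :
    addPoly π n ∈ supported O {i : ℕ ⊕ ℕ | i.elim id id ≤ n} := by
  refine mem_supported_of_ghost_mem_supported hπ.ne_zero (resCard O) fun m hm ↦ ?_
  rw [WittVec.ghost_addPoly hπ]
  have ghost_mem (j : ℕ → ℕ ⊕ ℕ) (hj : ∀ i, (j i).elim id id = i) :
      ghost (C π) (resCard O) m (fun i ↦ X (j i)) ∈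
        supported O {i : ℕ ⊕ ℕ | i.elim id id ≤ n} := by
    refine sum_mem fun i hi ↦ mul_mem (pow_mem (algebraMap_mem _ π) _) (pow_mem ?_ _)
    have hin : (j i).elim id id ≤ n :=
      (hj i).le.trans ((Nat.lt_succ_iff.1 (Finset.mem_range.1 hi)).trans hm)
    exact X_mem_supported.2 hin
  exact add_mem (ghost_mem _ fun _ ↦ rfl) (ghost_mem _ fun _ ↦ rfl)

lemma aeval_addPoly_congr (hπ : Irreducible π) {B : Type*} [CommRing B] [Algebra O B]
    {a a' b b' : ℕ → B} {n : ℕ} (ha : ∀ i ≤ n, a i = a' i) (hb : ∀ i ≤ n, b i = b' i) :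
    aeval (Sum.elim a b) (addPoly π n) = aeval (Sum.elim a' b') (addPoly π n) := by
  refine eval₂Hom_congr' rfl (fun i hi _ ↦ ?_) rfl
  have hin : i.elim id id ≤ n := mem_supported.1 (addPoly_mem_supported hπ n) hi
  rcases i with i | i
  exacts [ha i hin, hb i hin]

end AddPoly

section SubstHom

variable {R : Type*} [CommRing R] {S : Type*} [CommRing S] [Algebra R S]

variable (S) in
/-- The endomorphism `X n ↦ t n` of `S[X₀, X₁, …]`, for a sequence `t` of polynomials over a ring
`R` of which `S` is an algebra. -/
def substHom (t : ℕ → MvPolynomial ℕ R) : MvPolynomial ℕ S →ₐ[S] MvPolynomial ℕ S :=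
  aeval fun n ↦ map (algebraMap R S) (t n)

@[simp]
lemma substHom_X (t : ℕ → MvPolynomial ℕ R) (n : ℕ) :
    substHom S t (X n) = map (algebraMap R S) (t n) :=
  aeval_X _ _

lemma substHom_map (s t : ℕ → MvPolynomial ℕ R) (n : ℕ) :
    substHom S t (map (algebraMap R S) (s n)) = map (algebraMap R S) (aeval t (s n)) := by
  rw [substHom, aeval_map_algebraMap, map_aeval, aeval_def]
  exact eval₂Hom_congr (RingHom.ext fun x ↦ (map_C _ x).symm) rfl rfl

lemma substHom_comp_substHom (s t : ℕ → MvPolynomial ℕ R) :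
    (substHom S t).comp (substHom S s) = substHom S fun n ↦ aeval t (s n) := by
  ext1 n
  simp only [AlgHom.comp_apply, substHom_X, substHom_map]

end SubstHom

section ChangeOfUniformizer

variable {O : Type u} [CommRing O] [IsDomain O] [IsDiscreteValuationRing O] {π ϖ : O}

variable (π ϖ) in
/-- The change of uniformizer from `π` to `ϖ`: the polynomials whose Witt polynomials with respect
to `ϖ` are the Witt polynomials of the variables with respect to `π`. -/
def changePoly : ℕ → MvPolynomial ℕ O :=
  solve (C ϖ) (resCard O) fun n ↦ ghost (C π) (resCard O) n X

variable [Finite (IsLocalRing.ResidueField O)]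

lemma ghost_changePoly (hπ : Irreducible π) (hϖ : Irreducible ϖ) (n : ℕ) :
    ghost (C ϖ) (resCard O) n (changePoly π ϖ) = ghost (C π) (resCard O) n X := by
  refine ghost_solve_mvPolynomial hϖ (fun n ↦ ?_) n
  have hϖπ : ϖ ∣ π := (IsDiscreteValuationRing.associated_of_irreducible O hϖ hπ).dvd
  exact (pow_dvd_pow_of_dvd (map_dvd C hϖπ) _).trans
    (WittVec.dvd_expand_ghost (π := π) (fun i ↦ i) n)

lemma ghost_aeval_changePoly (hπ : Irreducible π) (hϖ : Irreducible ϖ) {B : Type*} [CommRing B]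
    [Algebra O B] (b : ℕ → B) (n : ℕ) :
    ghost (algebraMap O B ϖ) (resCard O) n (fun i ↦ aeval b (changePoly π ϖ i)) =
      ghost (algebraMap O B π) (resCard O) n b := by
  rw [← aeval_ghost_C, ghost_changePoly hπ hϖ, aeval_ghost_C]
  simp only [aeval_X]

lemma aeval_changePoly_changePoly (hπ : Irreducible π) (hϖ : Irreducible ϖ) :
    (fun n ↦ aeval (changePoly π ϖ) (changePoly ϖ π n)) = X :=
  ghost_injective (isLeftRegular_C hπ.ne_zero) (resCard O) fun n ↦
    (ghost_aeval_changePoly hϖ hπ _ n).trans (ghost_changePoly hπ hϖ n)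

lemma constantCoeff_changePoly (hπ : Irreducible π) (hϖ : Irreducible ϖ) (n : ℕ) :
    constantCoeff (changePoly π ϖ n) = 0 := by
  have aeval_zero_eq : (fun i ↦ aeval (0 : ℕ → O) (changePoly π ϖ i)) = 0 :=
    ghost_injective (IsRegular.of_ne_zero hϖ.ne_zero).left (resCard O) fun m ↦
      (ghost_aeval_changePoly hπ hϖ (0 : ℕ → O) m).trans <| by
        simp only [ghost_zero_right _ WittVec.resCard_ne_zero]
  simpa [aeval_zero] using congrFun aeval_zero_eq n

lemma substHom_changePoly_comp (hπ : Irreducible π) (hϖ : Irreducible ϖ) (S : Type*) [CommRing S]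
    [Algebra O S] :
    (substHom S (changePoly π ϖ)).comp (substHom S (changePoly ϖ π)) = .id _ _ := by
  rw [substHom_comp_substHom, aeval_changePoly_changePoly hπ hϖ]
  ext1 n
  simp

lemma substHom_changePoly_bijective (hπ : Irreducible π) (hϖ : Irreducible ϖ) (S : Type*)
    [CommRing S] [Algebra O S] : Function.Bijective (substHom S (changePoly π ϖ)) :=
  Function.bijective_iff_has_inverse.2 ⟨substHom S (changePoly ϖ π),
    AlgHom.congr_fun (substHom_changePoly_comp hϖ hπ S),
    AlgHom.congr_fun (substHom_changePoly_comp hπ hϖ S)⟩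

end ChangeOfUniformizer

lemma aeval_comp_X_eq_zero_iff {R ι κ B : Type*} [CommRing R] [CommRing B] [Algebra R B]
    {θ : MvPolynomial ι R →ₐ[R] MvPolynomial κ R} (hθ : Function.Surjective θ)
    (hθ₀ : ∀ i, constantCoeff (θ (X i)) = 0) (b : κ → B) :
    (∀ i, aeval b (θ (X i)) = 0) ↔ ∀ j, b j = 0 := by
  have aeval_zero_comp : (aeval (0 : κ → B)).comp θ = aeval (0 : ι → B) := by
    ext1 i
    simp [hθ₀ i]
  refine ⟨fun h j ↦ ?_, fun h i ↦ ?_⟩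
  · have hb : (aeval b).comp θ = (aeval 0).comp θ := by
      rw [aeval_zero_comp]
      ext1 i
      simpa using h i
    obtain ⟨f, hf⟩ := hθ (X j)
    simpa [hf] using AlgHom.congr_fun hb f
  · rw [show b = 0 from funext h]
    simpa using AlgHom.congr_fun aeval_zero_comp (X i)

lemma irreducible_algebraMap_of_unramified {O O' : Type*} [CommRing O] [IsDomain O]
    [IsDiscreteValuationRing O] [CommRing O'] [IsDomain O'] [IsDiscreteValuationRing O']
    [Algebra O O'] [IsLocalHom (algebraMap O O')] [Algebra.Unramified O O'] {π : O}
    (hπ : Irreducible π) : Irreducible (algebraMap O O' π) := by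
  rw [IsDiscreteValuationRing.irreducible_iff_uniformizer]
  have h := Algebra.FormallyUnramified.map_maximalIdeal (R := O) (S := O')
  rw [← h, hπ.maximalIdeal_eq, Ideal.map_span, Set.image_singleton]

section Drinfeld

variable {O O' : Type u} [CommRing O] [IsDomain O] [IsDiscreteValuationRing O]
  [Finite (IsLocalRing.ResidueField O)] [CommRing O'] [IsDomain O'] [IsDiscreteValuationRing O']
  [Finite (IsLocalRing.ResidueField O')] [Algebra O O'] [Module.Finite O O'] [FaithfulSMul O O']
  [Algebra.Unramified O O'] {π : O} {ϖ : O'} {r : ℕ}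

lemma dvd_drinfeldPoly_sub (hπ : Irreducible π) (hϖ : Irreducible ϖ)
    (hr : resCard O' = resCard O ^ r) (n : ℕ) :
    C ϖ ∣ drinfeldPoly π ϖ r n - aeval (fun i ↦ X i ^ resCard O ^ (i * (r - 1)))
      (changePoly (algebraMap O O' π) ϖ n) := by
  have hπ' : Irreducible (algebraMap O O' π) := irreducible_algebraMap_of_unramified hπ
  have hϖπ' : ϖ ∣ algebraMap O O' π :=
    (IsDiscreteValuationRing.associated_of_irreducible O' hϖ hπ').dvd
  have hQ : (C ϖ : MvPolynomial ℕ O') ∣ (resCard O' : MvPolynomial ℕ O') := by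
    simpa using map_dvd (C : O' →+* MvPolynomial ℕ O') (dvd_resCard hϖ)
  refine dvd_sub_of_pow_dvd_ghost_sub (isLeftRegular_C hϖ.ne_zero) hQ
    (c := fun n ↦ aeval (fun i ↦ X i ^ resCard O ^ (i * (r - 1)))
      (changePoly (algebraMap O O' π) ϖ n)) (fun m ↦ ?_) n
  have ghost_pow := ghost_aeval_changePoly hπ' hϖ
    (fun i ↦ (X i ^ resCard O ^ (i * (r - 1)) : MvPolynomial ℕ O')) m
  rw [algebraMap_eq] at ghost_pow
  rw [ghost_drinfeldPoly hπ hϖ hr, ghost_pow, hr]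
  exact (pow_dvd_pow_of_dvd (map_dvd C hϖπ') _).trans
    (pow_dvd_ghost_mul_sub_ghost_pow _ _ (ne_zero_of_resCard_eq hr) X m)

variable {S : Type*} [CommRing S] [Algebra O' S]

lemma map_drinfeldPoly (hπ : Irreducible π) (hϖ : Irreducible ϖ)
    (hr : resCard O' = resCard O ^ r) (hS : algebraMap O' S ϖ = 0) (n : ℕ) :
    map (algebraMap O' S) (drinfeldPoly π ϖ r n) = aeval (fun i ↦ X i ^ resCard O ^ (i * (r - 1)))
      (map (algebraMap O' S) (changePoly (algebraMap O O' π) ϖ n)) := by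
  obtain ⟨d, hd⟩ := dvd_drinfeldPoly_sub hπ hϖ hr n
  rw [eq_add_of_sub_eq hd, map_add, map_mul, map_C, hS, C_0, zero_mul, zero_add]
  refine (substHom_map (S := S) _ _ n).symm.trans ?_
  simp only [substHom, map_pow, map_X]

lemma substHom_drinfeldPoly (hπ : Irreducible π) (hϖ : Irreducible ϖ)
    (hr : resCard O' = resCard O ^ r) (hS : algebraMap O' S ϖ = 0) :
    substHom S (drinfeldPoly π ϖ r) = (aeval fun i ↦ X i ^ resCard O ^ (i * (r - 1))).comp
      (substHom S (changePoly (algebraMap O O' π) ϖ)) := by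
  ext1 n
  simp only [AlgHom.comp_apply, substHom_X, map_drinfeldPoly hπ hϖ hr hS]

lemma aeval_map_drinfeldPoly_eq_zero_iff (hπ : Irreducible π) (hϖ : Irreducible ϖ)
    (hr : resCard O' = resCard O ^ r) (hS : algebraMap O' S ϖ = 0) {B : Type*} [CommRing B]
    [Algebra S B] (a : ℕ → B) :
    (∀ n, aeval a (map (algebraMap O' S) (drinfeldPoly π ϖ r n)) = 0) ↔
      ∀ n, a n ^ resCard O ^ (n * (r - 1)) = 0 := by
  have hπ' : Irreducible (algebraMap O O' π) := irreducible_algebraMap_of_unramified hπ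
  have constantCoeff_zero (n : ℕ) :
      constantCoeff (substHom S (changePoly (algebraMap O O' π) ϖ) (X n)) = 0 := by
    rw [substHom_X, constantCoeff_map, constantCoeff_changePoly hπ' hϖ, map_zero]
  rw [← aeval_comp_X_eq_zero_iff (substHom_changePoly_bijective hπ' hϖ S).2 constantCoeff_zero
    fun i ↦ a i ^ resCard O ^ (i * (r - 1))]
  refine forall_congr' fun n ↦ ?_
  rw [map_drinfeldPoly hπ hϖ hr hS, substHom_X, ← AlgHom.comp_apply, comp_aeval]
  simp only [map_pow, aeval_X]

end Drinfeld

section PRadical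

lemma isPRadical_of_bijective {A B : Type*} [CommRing A] [CommRing B] {f : A →+* B} (p : ℕ)
    (hf : Function.Bijective f) : IsPRadical f p where
  pow_mem' b := by
    obtain ⟨a, rfl⟩ := hf.2 b
    exact ⟨0, a, by simp⟩
  ker_le' := ((RingHom.injective_iff_ker_eq_bot f).1 hf.1).trans_le bot_le

lemma aeval_X_pow_injective {R ι : Type*} [CommRing R] {e : ι → ℕ} (he : ∀ i, e i ≠ 0) :
    Function.Injective (aeval fun i ↦ X i ^ e i : MvPolynomial ι R →ₐ[R] MvPolynomial ι R) := by
  have := algebraicIndependent_polynomial_aeval_X (ι := ι) (R := R) (fun i ↦ Polynomial.X ^ e i)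
    fun i ↦ (Polynomial.transcendental_X R).pow (Nat.pos_of_ne_zero (he i))
  simpa [AlgebraicIndependent] using this

lemma isPRadical_aeval_X_pow {R ι : Type*} [CommRing R] (p : ℕ) [ExpChar R p] (m : ι → ℕ) :
    IsPRadical (aeval fun i ↦ X i ^ p ^ m i : MvPolynomial ι R →ₐ[R] MvPolynomial ι R).toRingHom
      p := by
  set φ : MvPolynomial ι R →ₐ[R] MvPolynomial ι R := aeval fun i ↦ X i ^ p ^ m i
  have pow_mem_of_le {f : MvPolynomial ι R} {N M : ℕ} (h : f ^ p ^ N ∈ φ.range) (hNM : N ≤ M) :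
      f ^ p ^ M ∈ φ.range := by
    obtain ⟨d, rfl⟩ := Nat.exists_eq_add_of_le hNM
    rw [pow_add, pow_mul]
    exact pow_mem h _
  refine ⟨fun f ↦ ?_, ((RingHom.injective_iff_ker_eq_bot _).1 (aeval_X_pow_injective
    fun i ↦ pow_ne_zero _ (expChar_ne_zero R p))).trans_le bot_le⟩
  change ∃ N, f ^ p ^ N ∈ φ.range
  induction f using MvPolynomial.induction_on with
  | C a => exact ⟨0, C a, by simp⟩
  | add f g hf hg =>
    obtain ⟨N, hN⟩ := hf
    obtain ⟨M, hM⟩ := hg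
    refine ⟨max N M, ?_⟩
    rw [add_pow_expChar_pow]
    exact add_mem (pow_mem_of_le hN (le_max_left _ _)) (pow_mem_of_le hM (le_max_right _ _))
  | mul_X f i hf =>
    obtain ⟨N, hN⟩ := hf
    have hX : (X i : MvPolynomial ι R) ^ p ^ m i ∈ φ.range := ⟨X i, aeval_X _ _⟩
    refine ⟨max N (m i), ?_⟩
    rw [mul_pow]
    exact mul_mem (pow_mem_of_le hN (le_max_left _ _)) (pow_mem_of_le hX (le_max_right _ _))

end PRadical

section Drinfeld

variable {O O' : Type u} [CommRing O] [IsDomain O] [IsDiscreteValuationRing O]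
  [Finite (IsLocalRing.ResidueField O)] [CommRing O'] [IsDomain O'] [IsDiscreteValuationRing O']
  [Finite (IsLocalRing.ResidueField O')] [Algebra O O'] [Module.Finite O O'] [FaithfulSMul O O']
  [Algebra.Unramified O O'] {π : O} {ϖ : O'} {r : ℕ} {S : Type*} [CommRing S] [Algebra O' S]

lemma isPRadical_substHom_drinfeldPoly (hπ : Irreducible π) (hϖ : Irreducible ϖ)
    (hr : resCard O' = resCard O ^ r) (hS : algebraMap O' S ϖ = 0) (p : ℕ) [ExpChar S p] {h : ℕ}
    (hq : resCard O = p ^ h) :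
    IsPRadical (substHom S (drinfeldPoly π ϖ r)).toRingHom p := by
  have isPRadical_change : IsPRadical (substHom S (changePoly (algebraMap O O' π) ϖ)).toRingHom p :=
    isPRadical_of_bijective p
      (substHom_changePoly_bijective (irreducible_algebraMap_of_unramified hπ) hϖ S)
  have frobenius := isPRadical_aeval_X_pow (R := S) p fun i : ℕ ↦ h * (i * (r - 1))
  rw [substHom_drinfeldPoly hπ hϖ hr hS]
  simp only [hq, ← pow_mul]
  exact isPRadical_change.trans _ _ p

end Drinfeld

/-! ### Universal homeomorphisms -/

section

open AlgebraicGeometry CategoryTheory MorphismProperty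

lemma isUniversalHomeomorphism_of_isIntegralHom {X Y : Scheme.{u}} (f : X ⟶ Y)
    [IsIntegralHom f] [Surjective f] [UniversallyInjective f] : IsUniversalHomeomorphism f := by
  intro X' Y' i₁ i₂ f' h
  have : IsIntegralHom f' := of_isPullback h.flip ‹_›
  have : Surjective f' := of_isPullback h.flip ‹_›
  have : UniversallyInjective f' := of_isPullback h.flip ‹_›
  exact isHomeomorph_iff_continuous_isClosedMap_bijective.2
    ⟨f'.continuous, f'.isClosedMap, f'.injective, f'.surjective⟩

lemma IsUniversalHomeomorphism.of_arrow_iso {X Y X' Y' : Scheme.{u}} {f : X ⟶ Y} {f' : X' ⟶ Y'}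
    (e : CategoryTheory.Arrow.mk f ≅ CategoryTheory.Arrow.mk f')
    (hf : IsUniversalHomeomorphism f) : IsUniversalHomeomorphism f' :=
  (arrow_mk_iso_iff (universally _) e).1 hf

section PRadical

variable {A B : Type u} [CommRing A] [CommRing B] (f : A →+* B) (p : ℕ)

lemma isIntegral_of_isPRadical [ExpChar A p] [IsPRadical f p] : f.IsIntegral := fun b ↦ by
  obtain ⟨n, a, ha⟩ := IsPRadical.pow_mem f p b
  have hn : p ^ n ≠ 0 := (expChar_pow_pos A p n).ne'
  exact ⟨Polynomial.X ^ p ^ n - Polynomial.C a, Polynomial.monic_X_pow_sub_C a hn, by simp [ha]⟩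

lemma universallyInjective_SpecMap_of_isPRadical [Fact p.Prime] [CharP A p] [IsPRadical f p] :
    UniversallyInjective (Spec.map (CommRingCat.ofHom f)) := by
  suffices h : ∀ (K : Type u) [Field K], Function.Injective fun g : Spec (.of K) ⟶ Spec (.of B) ↦
      g ≫ Spec.map (CommRingCat.ofHom f) from ((tfae_universallyInjective _).out 0 1).2 h
  intro K _ g₁ g₂ h
  obtain ⟨g₁, rfl⟩ := Spec.map_surjective g₁
  obtain ⟨g₂, rfl⟩ := Spec.map_surjective g₂
  simp only [← Spec.map_comp] at h
  have hf : g₁.hom.comp f = g₂.hom.comp f :=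
    congrArg CommRingCat.Hom.hom (Spec.map_injective h)
  have : CharP K p := (CharP.charP_iff_prime_eq_zero Fact.out).2 <| by
    rw [← map_natCast (g₁.hom.comp f), CharP.cast_eq_zero, map_zero]
  exact congrArg Spec.map (CommRingCat.hom_ext (IsPRadical.injective_comp K f p hf))

lemma isUniversalHomeomorphism_SpecMap_of_isPRadical [Fact p.Prime] [CharP A p]
    [IsPRadical f p] : IsUniversalHomeomorphism (Spec.map (CommRingCat.ofHom f)) := by
  have : IsIntegralHom (Spec.map (CommRingCat.ofHom f)) :=
    IsIntegralHom.SpecMap_iff.2 (isIntegral_of_isPRadical f p)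
  have : Surjective (Spec.map (CommRingCat.ofHom f)) :=
    ⟨(PrimeSpectrum.isHomeomorph_comap f (fun b ↦ by
        obtain ⟨n, hn⟩ := IsPRadical.pow_mem f p b
        exact ⟨p ^ n, expChar_pow_pos A p n, hn⟩)
      ((IsPRadical.ker_le f p).trans pNilradical_le_nilradical)).surjective⟩
  have := universallyInjective_SpecMap_of_isPRadical f p
  exact isUniversalHomeomorphism_of_isIntegralHom _

end PRadical

end

/-! ### Coordinates on the schemes of Witt vectors -/

open AlgebraicGeometry CategoryTheory Limits Opposite MonoidalCategory CartesianMonoidalCategory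
  MonObj

section BaseChange

open scoped Obj

variable {S S' : Scheme.{u}} {b : S' ⟶ S} {Y : Over S} {T : Over S'}

lemma toBase_comp_map {Y' : Over S} (f : T ⟶ (Over.pullback b).obj Y) (u : Y ⟶ Y') :
    toBase (f ≫ (Over.pullback b).map u) = toBase f ≫ u := by
  ext1
  exact (Category.assoc _ _ _).trans ((congrArg (f.left ≫ ·) (pullback.lift_fst _ _ _)).trans
    (Category.assoc _ _ _).symm)

lemma toBase_bijective :
    Function.Bijective (toBase : (T ⟶ (Over.pullback b).obj Y) → ((Over.map b).obj T ⟶ Y)) := by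
  refine ⟨fun f g h ↦ ?_, fun g ↦ ?_⟩
  · ext1
    exact pullback.hom_ext (congrArg (·.left) h) ((Over.w f).trans (Over.w g).symm)
  · refine ⟨Over.homMk (pullback.lift g.left T.hom (Over.w g)) (pullback.lift_snd _ _ _), ?_⟩
    ext1
    exact pullback.lift_fst _ _ _

lemma toBase_one [GrpObj Y] : toBase (1 : T ⟶ (Over.pullback b).obj Y) = 1 := by
  have h := toBase_mul (1 : T ⟶ (Over.pullback b).obj Y) 1
  rw [_root_.one_mul] at h
  exact left_eq_mul.1 h

end BaseChange

section AffineSpace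

variable {k : Type u} [CommRing k]

/-- The endomorphism of `Spec k[X₀, X₁, …]` given by an endomorphism of `k[X₀, X₁, …]`. -/
def affineSpaceMap (θ : MvPolynomial ℕ k →ₐ[k] MvPolynomial ℕ k) : affineSpace k ⟶ affineSpace k :=
  Over.homMk (Spec.map (CommRingCat.ofHom θ.toRingHom)) <| by
    simp only [affineSpace, Over.mk_hom, ← Spec.map_comp, ← CommRingCat.ofHom_comp]
    congr 2
    exact θ.comp_algebraMap

lemma appTop_ΓSpecIso_inv {T : Over (Spec (.of k))} (f : T ⟶ affineSpace k)
    (P : MvPolynomial ℕ k) :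
    f.left.appTop ((Scheme.ΓSpecIso (.of (MvPolynomial ℕ k))).inv P) =
      aeval (S₁ := sections T) (homEquiv T f) P := by
  have h : ((Scheme.ΓSpecIso (.of (MvPolynomial ℕ k))).inv ≫ f.left.appTop).hom =
      (aeval (homEquiv T f) : MvPolynomial ℕ k →ₐ[k] sections T).toRingHom := by
    refine MvPolynomial.ringHom_ext (fun x ↦ ?_) fun i ↦ ?_
    · refine Eq.trans ?_ (aeval_C (S₁ := sections T) _ x).symm
      exact (ConcreteCategory.congr_hom (ΓSpecIso_inv_comp_appTop (CommRingCat.ofHom C) f.left T.hom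
        (Over.w f)) x).symm
    · exact (aeval_X (R := k) (S₁ := sections T) (homEquiv T f) i).symm
  exact RingHom.congr_fun h P

lemma homEquiv_comp_affineSpaceMap {T : Over (Spec (.of k))} (f : T ⟶ affineSpace k)
    (θ : MvPolynomial ℕ k →ₐ[k] MvPolynomial ℕ k) (n : ℕ) :
    homEquiv T (f ≫ affineSpaceMap θ) n = aeval (homEquiv T f) (θ (X n)) := by
  rw [← appTop_ΓSpecIso_inv]
  refine congrArg f.left.appTop ?_
  exact (ConcreteCategory.congr_hom
    (Scheme.ΓSpecIso_inv_naturality (CommRingCat.ofHom θ.toRingHom)) (X n)).symm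

end AffineSpace

section BaseChangeCoords

variable {R S : Type u} [CommRing R] [CommRing S] [Algebra R S] {Y Z : Over (Spec (.of R))}
  {T : Over (Spec (.of S))}

lemma coords_bijective : Function.Bijective (coords (O := R) (T := T)) :=
  (homEquiv _).bijective.comp toBase_bijective

lemma aeval_map_algebraMap_sections (v : ℕ → sections T) (P : MvPolynomial ℕ R) :
    aeval v (map (algebraMap R S) P) =
      aeval (S₁ := sections ((Over.map (baseMap R S)).obj T)) v P := by
  let : Algebra R (sections T) :=
    inferInstanceAs (Algebra R (sections ((Over.map (baseMap R S)).obj T)))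
  have : IsScalarTower R S (sections T) := .of_algebraMap_eq fun x ↦
    ConcreteCategory.congr_hom (ΓSpecIso_inv_comp_appTop (CommRingCat.ofHom (algebraMap R S)) T.hom
      ((Over.map (baseMap R S)).obj T).hom rfl) x
  exact aeval_map_algebraMap S v P

lemma coords_comp_map_affineSpaceMap (f : T ⟶ (Over.pullback (baseMap R S)).obj (affineSpace R))
    (t : ℕ → MvPolynomial ℕ R) (n : ℕ) :
    coords (f ≫ (Over.pullback (baseMap R S)).map (affineSpaceMap (aeval t))) n =
      aeval (coords f) (map (algebraMap R S) (t n)) := by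
  rw [aeval_map_algebraMap_sections, coords, toBase_comp_map, homEquiv_comp_affineSpaceMap, aeval_X]
  rfl

variable (S) in
/-- The base change along `R → S` of a morphism to `Spec R[X₀, X₁, …]`, as a morphism to
`Spec S[X₀, X₁, …]`. It serves to transport coordinates on an `R`-scheme to its base change. -/
def baseChangeCoords (κ : Y ⟶ affineSpace R) :
    (Over.pullback (baseMap R S)).obj Y ⟶ affineSpace S :=
  (Over.pullback (baseMap R S)).map κ ≫ (homEquiv _).symm (coords (𝟙 _))

lemma map_comp_baseChangeCoords (g : Y ⟶ Z) (κ : Z ⟶ affineSpace R) :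
    (Over.pullback (baseMap R S)).map g ≫ baseChangeCoords S κ = baseChangeCoords S (g ≫ κ) := by
  rw [baseChangeCoords, baseChangeCoords, Functor.map_comp, Category.assoc]

lemma homEquiv_comp_baseChangeCoords (f : T ⟶ (Over.pullback (baseMap R S)).obj Y)
    (κ : Y ⟶ affineSpace R) :
    homEquiv T (f ≫ baseChangeCoords S κ) =
      coords (f ≫ (Over.pullback (baseMap R S)).map κ) := by
  funext i
  rw [baseChangeCoords, ← Category.assoc, homEquiv_comp, Equiv.apply_symm_apply, ← coords_comp,
    Category.comp_id]

lemma baseChangeCoords_comp_affineSpaceMap (κ : Y ⟶ affineSpace R)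
    (t : ℕ → MvPolynomial ℕ R) :
    baseChangeCoords S (κ ≫ affineSpaceMap (aeval t)) =
      baseChangeCoords S κ ≫ affineSpaceMap (substHom S t) := by
  apply (homEquiv _).injective
  funext n
  rw [← Category.id_comp (baseChangeCoords S _), ← Category.id_comp (baseChangeCoords S κ),
    homEquiv_comp_affineSpaceMap, substHom_X, homEquiv_comp_baseChangeCoords,
    homEquiv_comp_baseChangeCoords, Functor.map_comp, ← Category.assoc,
    coords_comp_map_affineSpaceMap]

instance (κ : Y ⟶ affineSpace R) [IsIso κ] : IsIso (baseChangeCoords S κ) := by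
  refine isIso_of_yoneda_map_bijective _ fun T ↦ ?_
  rw [← (homEquiv T).comp_bijective]
  have h : homEquiv T ∘ (· ≫ baseChangeCoords S κ) =
      coords ∘ (· ≫ (Over.pullback (baseMap R S)).map κ) :=
    funext fun f ↦ homEquiv_comp_baseChangeCoords f κ
  rw [h]
  exact coords_bijective.comp (asIso ((Over.pullback (baseMap R S)).map κ)).homToEquiv.bijective

end BaseChangeCoords

section Triangular

/-- Coordinates `κ` on a group scheme are triangular if the unit has zero coordinates and the
`n`-th coordinate of a product depends only on the coordinates of index at most `n` of the
factors. -/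
structure IsTriangular {R : Type u} [CommRing R] {Y : Over (Spec (.of R))} [GrpObj Y]
    (κ : Y ⟶ affineSpace R) : Prop where
  one (T : Over (Spec (.of R))) : homEquiv T (1 ≫ κ) = 0
  mul_congr {T : Over (Spec (.of R))} {f f' g g' : T ⟶ Y} {n : ℕ}
    (hf : ∀ i ≤ n, homEquiv T (f ≫ κ) i = homEquiv T (f' ≫ κ) i)
    (hg : ∀ i ≤ n, homEquiv T (g ≫ κ) i = homEquiv T (g' ≫ κ) i) :
    homEquiv T ((f * g) ≫ κ) n = homEquiv T ((f' * g') ≫ κ) n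

lemma IsTriangular.comp {R : Type u} [CommRing R] {Y Y' : Over (Spec (.of R))} [GrpObj Y]
    [GrpObj Y'] {κ : Y ⟶ affineSpace R} (hκ : IsTriangular κ) (u : Y' ⟶ Y) [IsMonHom u] :
    IsTriangular (u ≫ κ) where
  one T := by rw [← Category.assoc, MonObj.one_comp, hκ.one]
  mul_congr {_ f f' g g' _} hf hg := by
    simp only [← Category.assoc] at hf hg ⊢
    rw [MonObj.mul_comp f g u, MonObj.mul_comp f' g' u]
    exact hκ.mul_congr hf hg

open scoped Obj in
lemma IsTriangular.baseChangeCoords {R S : Type u} [CommRing R] [CommRing S] [Algebra R S]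
    {Y : Over (Spec (.of R))} [GrpObj Y] {κ : Y ⟶ affineSpace R} (hκ : IsTriangular κ) :
    IsTriangular (baseChangeCoords S κ) where
  one T := by
    rw [homEquiv_comp_baseChangeCoords, coords, toBase_comp_map, toBase_one, hκ.one]
    rfl
  mul_congr hf hg := by
    simp only [homEquiv_comp_baseChangeCoords, coords, toBase_comp_map, toBase_mul] at hf hg ⊢
    exact hκ.mul_congr hf hg

variable {O : Type u} [CommRing O] [IsDomain O] [IsDiscreteValuationRing O]
  [Finite (IsLocalRing.ResidueField O)] {π : O} (hπ : Irreducible π)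

/-- The coordinates on the scheme of ramified Witt vectors. -/
def wittCoords : (wittScheme hπ).X ⟶ affineSpace O := 𝟙 (affineSpace O)

instance : IsIso (wittCoords hπ) := inferInstanceAs (IsIso (𝟙 (affineSpace O)))

lemma homEquiv_comp_wittCoords {T : Over (Spec (.of O))} (f : T ⟶ (wittScheme hπ).X) :
    homEquiv T (f ≫ wittCoords hπ) = wittEquiv hπ T f :=
  congrArg (homEquiv T) (Category.comp_id f)

lemma isTriangular_wittCoords : IsTriangular (wittCoords hπ) where
  one T := by
    have h := wittEquiv_mul hπ (1 : T ⟶ (wittScheme hπ).X) 1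
    rw [_root_.one_mul, left_eq_add] at h
    exact (homEquiv_comp_wittCoords hπ 1).trans h
  mul_congr {T f f' g g' n} hf hg := by
    simp only [homEquiv_comp_wittCoords, wittEquiv_mul] at hf hg ⊢
    exact aeval_addPoly_congr hπ hf hg

end Triangular

section SpecialFiber

open IsLocalRing (ResidueField)

variable {O O' : Type u} [CommRing O] [IsDomain O] [IsDiscreteValuationRing O]
  [CommRing O'] [IsDomain O'] [IsDiscreteValuationRing O'] [Algebra O O'] {π : O} {ϖ : O'}

lemma drinfeldHom_eq (r : ℕ) :
    drinfeldHom O O' π ϖ r =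
      baseChangeCoords O' (𝟙 (affineSpace O)) ≫ affineSpaceMap (aeval (drinfeldPoly π ϖ r)) := by
  apply (homEquiv _).injective
  rw [← Category.id_comp (drinfeldHom O O' π ϖ r), homEquiv_comp_drinfeldHom]
  funext n
  rw [homEquiv_comp_affineSpaceMap, aeval_X, ← Category.id_comp (baseChangeCoords O' _),
    homEquiv_comp_baseChangeCoords, CategoryTheory.Functor.map_id, Category.comp_id]

variable [Finite (ResidueField O)]

variable (O') in
/-- The special fiber of the base change to `O'` of the scheme of ramified Witt vectors over `O`. -/
abbrev wittFiber (hπ : Irreducible π) : Grp (Over (Spec (.of (ResidueField O')))) :=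
  (Over.pullback (baseMap O' (ResidueField O'))).mapGrp.obj
    ((Over.pullback (baseMap O O')).mapGrp.obj (wittScheme hπ))

variable (O') in
/-- The coordinates on the special fiber of the base change to `O'` of the scheme of ramified Witt
vectors over `O`. -/
def wittFiberCoords (hπ : Irreducible π) : (wittFiber O' hπ).X ⟶ affineSpace (ResidueField O') :=
  baseChangeCoords (ResidueField O') (baseChangeCoords O' (wittCoords hπ))

instance (hπ : Irreducible π) : IsIso (wittFiberCoords O' hπ) :=
  inferInstanceAs (IsIso (baseChangeCoords _ (baseChangeCoords _ _)))

open scoped Obj in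
lemma isTriangular_wittFiberCoords (hπ : Irreducible π) : IsTriangular (wittFiberCoords O' hπ) :=
  (isTriangular_wittCoords hπ).baseChangeCoords.baseChangeCoords

variable [Finite (ResidueField O')] [Module.Finite O O'] [FaithfulSMul O O']

lemma drinfeldSpecialFiber_comp_baseChangeCoords (hπ : Irreducible π) (hϖ : Irreducible ϖ) {r : ℕ}
    (hr : resCard O' = resCard O ^ r) :
    (drinfeldSpecialFiber hπ hϖ hr).hom.hom ≫ baseChangeCoords (ResidueField O') (wittCoords hϖ) =
      wittFiberCoords O' hπ ≫ affineSpaceMap (substHom (ResidueField O') (drinfeldPoly π ϖ r)) := by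
  have h : baseChangeCoords (ResidueField O') (drinfeldHom O O' π ϖ r) =
      baseChangeCoords (ResidueField O') (baseChangeCoords O' (𝟙 (affineSpace O))) ≫
        affineSpaceMap (substHom (ResidueField O') (drinfeldPoly π ϖ r)) := by
    rw [drinfeldHom_eq, baseChangeCoords_comp_affineSpaceMap]
  exact (map_comp_baseChangeCoords (drinfeldHom O O' π ϖ r) (𝟙 _)).trans
    ((congrArg _ (Category.comp_id _)).trans h)

variable [Algebra.Unramified O O']

lemma isUniversalHomeomorphism_drinfeldSpecialFiber (hπ : Irreducible π) (hϖ : Irreducible ϖ)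
    {r : ℕ} (hr : resCard O' = resCard O ^ r) :
    IsUniversalHomeomorphism (drinfeldSpecialFiber hπ hϖ hr).hom.hom.left := by
  obtain ⟨p, h, hp, hq, hpp⟩ := exists_resCard_eq hπ
  have : Fact p.Prime := ⟨hp⟩
  have hpp' : algebraMap O O' π ∣ (p : O') := by simpa using map_dvd (algebraMap O O') hpp
  have : CharP (ResidueField O') p := (CharP.charP_iff_prime_eq_zero hp).2 <| by
    rw [← map_natCast (IsLocalRing.residue O'),
      ← dvd_iff_residue (irreducible_algebraMap_of_unramified hπ)]
    exact hpp'
  have := isPRadical_substHom_drinfeldPoly hπ hϖ hr ((dvd_iff_residue hϖ ϖ).1 dvd_rfl) p hq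
  let θ := substHom (ResidueField O') (drinfeldPoly π ϖ r)
  let κ : ((Over.pullback (baseMap O' (ResidueField O'))).mapGrp.obj (wittScheme hϖ)).X ⟶ _ :=
    baseChangeCoords (ResidueField O') (wittCoords hϖ)
  have : IsIso κ := inferInstanceAs (IsIso (baseChangeCoords _ _))
  let e : Arrow.mk (drinfeldSpecialFiber hπ hϖ hr).hom.hom ≅ Arrow.mk (affineSpaceMap θ) :=
    Arrow.isoMk (asIso (wittFiberCoords O' hπ)) (asIso κ)
      (drinfeldSpecialFiber_comp_baseChangeCoords hπ hϖ hr).symm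
  exact (isUniversalHomeomorphism_SpecMap_of_isPRadical θ.toRingHom p).of_arrow_iso
    ((Over.forget _).mapArrow.mapIso e).symm

open scoped Obj in
lemma comp_drinfeldSpecialFiber_eq_one_iff (hπ : Irreducible π) (hϖ : Irreducible ϖ) {r : ℕ}
    (hr : resCard O' = resCard O ^ r) {T : Over (Spec (.of (ResidueField O')))}
    (f : T ⟶ (wittFiber O' hπ).X) :
    f ≫ (drinfeldSpecialFiber hπ hϖ hr).hom.hom = 1 ↔
      ∀ n, homEquiv T (f ≫ wittFiberCoords O' hπ) n ^ resCard O ^ (n * (r - 1)) = 0 := by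
  let κ : ((Over.pullback (baseMap O' (ResidueField O'))).mapGrp.obj (wittScheme hϖ)).X ⟶ _ :=
    baseChangeCoords (ResidueField O') (wittCoords hϖ)
  have : IsIso κ := inferInstanceAs (IsIso (baseChangeCoords _ _))
  have hκ : IsTriangular κ := (isTriangular_wittCoords hϖ).baseChangeCoords
  rw [← aeval_map_drinfeldPoly_eq_zero_iff hπ hϖ hr ((dvd_iff_residue hϖ ϖ).1 dvd_rfl),
    ← cancel_mono κ, Category.assoc, drinfeldSpecialFiber_comp_baseChangeCoords,
    ← (homEquiv T).injective.eq_iff, hκ.one, funext_iff]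
  simp only [← Category.assoc, homEquiv_comp_affineSpaceMap, substHom_X, Pi.zero_apply]

end SpecialFiber

/-! ### Kernels and retracts of group objects -/

section Kernel

variable {C : Type*} [Category.{v} C] [CartesianMonoidalCategory C]
  [HasLimitsOfShape WalkingParallelPair C] {G G' : Grp C} (u : G ⟶ G')

/-- The kernel of a homomorphism of group objects is an equalizer of the underlying objects. -/
def isLimitForkKernel : IsLimit (Fork.ofι (f := u.hom.hom) (g := (0 : G ⟶ G').hom.hom)
    (kernel.ι u).hom.hom (congrArg (fun x ↦ x.hom.hom)
      ((kernel.condition u).trans comp_zero.symm))) :=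
  isLimitForkMapOfIsLimit (Grp.forget C) _ (kernelIsKernel u)

instance : Mono (kernel.ι u).hom.hom :=
  ⟨fun _ _ h ↦ Fork.IsLimit.hom_ext (isLimitForkKernel u) h⟩

lemma exists_comp_kernel_ι_eq_iff {T : C} (g : T ⟶ G.X) :
    (∃ f : T ⟶ (kernel u).X, f ≫ (kernel.ι u).hom.hom = g) ↔ g ≫ u.hom.hom = 1 := by
  constructor
  · rintro ⟨f, rfl⟩
    have h : (kernel.ι u).hom.hom ≫ u.hom.hom = 1 :=
      congrArg (fun x ↦ x.hom.hom) (kernel.condition u)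
    rw [Category.assoc, h, MonObj.comp_one]
  · intro hg
    have h : g ≫ (0 : G ⟶ G').hom.hom = 1 := MonObj.comp_one (M := G'.X) g
    exact ⟨Fork.IsLimit.lift (isLimitForkKernel u) g (hg.trans h.symm),
      Fork.IsLimit.lift_ι (isLimitForkKernel u)⟩

end Kernel

section Retract

variable {C : Type*} [Category.{v} C] [CartesianMonoidalCategory C] {G Z : C} [GrpObj G]
  {p : G ⟶ Z} {s : Z ⟶ G}

variable (p s) in
/-- A retraction `p` of a group object onto an object `Z`, with section `s`, that is compatible
with multiplication: then `Z` is a group object and `p` is a homomorphism, although `s` need not be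
one. -/
structure IsGroupRetract : Prop where
  section_comp_retraction : s ≫ p = 𝟙 Z
  mul_congr ⦃T : C⦄ ⦃a a' b b' : T ⟶ G⦄ (ha : a ≫ p = a' ≫ p) (hb : b ≫ p = b' ≫ p) :
    (a * b) ≫ p = (a' * b') ≫ p

namespace IsGroupRetract

variable (h : IsGroupRetract p s)

include h

lemma comp_section_comp_retraction {T : C} (x : T ⟶ Z) : (x ≫ s) ≫ p = x := by
  rw [Category.assoc, h.section_comp_retraction, Category.comp_id]

/-- The group structure on the points of a group retract. -/
abbrev group (T : C) : Group (T ⟶ Z) :=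
  letI : Mul (T ⟶ Z) := ⟨fun x y ↦ ((x ≫ s) * (y ≫ s)) ≫ p⟩
  letI : One (T ⟶ Z) := ⟨(1 : T ⟶ G) ≫ p⟩
  letI : Inv (T ⟶ Z) := ⟨fun x ↦ (x ≫ s)⁻¹ ≫ p⟩
  Group.ofLeftAxioms
    (fun x y z ↦ (h.mul_congr (h.comp_section_comp_retraction _) rfl).trans
      ((congrArg (· ≫ p) (mul_assoc (x ≫ s) (y ≫ s) (z ≫ s))).trans
        (h.mul_congr rfl (h.comp_section_comp_retraction _).symm)))
    (fun x ↦ (h.mul_congr (h.comp_section_comp_retraction _) rfl).trans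
      ((congrArg (· ≫ p) (one_mul (x ≫ s))).trans (h.comp_section_comp_retraction x)))
    (fun x ↦ (h.mul_congr (h.comp_section_comp_retraction _) rfl).trans
      (congrArg (· ≫ p) (inv_mul_cancel (x ≫ s))))

/-- The presheaf of groups of points of a group retract. -/
def presheaf : Cᵒᵖ ⥤ GrpCat.{v} where
  obj T := letI := h.group T.unop; GrpCat.of (T.unop ⟶ Z)
  map {T T'} f :=
    letI := h.group T.unop
    letI := h.group T'.unop
    GrpCat.ofHom
    { toFun x := f.unop ≫ x
      map_one' := by
        change f.unop ≫ (1 : T.unop ⟶ G) ≫ p = (1 : T'.unop ⟶ G) ≫ p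
        rw [← Category.assoc, comp_one]
      map_mul' x y := by
        change f.unop ≫ ((x ≫ s) * (y ≫ s)) ≫ p = (((f.unop ≫ x) ≫ s) * ((f.unop ≫ y) ≫ s)) ≫ p
        rw [← Category.assoc, comp_mul, Category.assoc, Category.assoc] }
  map_id T :=
    letI := h.group T.unop
    GrpCat.hom_ext <| MonoidHom.ext fun x ↦ Category.id_comp x
  map_comp {T _ T'} f g :=
    letI := h.group T.unop
    letI := h.group T'.unop
    GrpCat.hom_ext <| MonoidHom.ext fun x ↦ Category.assoc _ _ x

/-- A group retract represents its presheaf of groups of points. -/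
def representableBy : (h.presheaf ⋙ forget GrpCat).RepresentableBy Z where
  homEquiv := .refl _
  homEquiv_comp _ _ := rfl

/-- The group object structure on a group retract. -/
abbrev grpObj : GrpObj Z := GrpObj.ofRepresentableBy _ _ h.representableBy

lemma mul_eq {T : C} (x y : T ⟶ Z) :
    letI := h.grpObj
    x * y = ((x ≫ s) * (y ≫ s)) ≫ p :=
  ((yonedaGrpObjIsoOfRepresentableBy _ _ h.representableBy).hom.app (op T)).hom.map_mul x y

lemma mul_comp {T : C} (a b : T ⟶ G) :
    letI := h.grpObj
    (a * b) ≫ p = (a ≫ p) * (b ≫ p) :=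
  (h.mul_congr (h.comp_section_comp_retraction _).symm
    (h.comp_section_comp_retraction _).symm).trans (h.mul_eq _ _).symm

end IsGroupRetract

end Retract

section RetractTower

variable {C : Type*} [Category.{v} C] [CartesianMonoidalCategory C] {I : Type*} [Preorder I]
  {G : Grp C} {Z : I → C} {p : ∀ i, G.X ⟶ Z i} {s : ∀ i, Z i ⟶ G.X}

variable (p s) in
/-- A family of group retracts of the same group object, such that each retraction factors through
those of larger index. -/
structure IsGroupRetractSystem : Prop where
  isGroupRetract (i : I) : IsGroupRetract (p i) (s i)
  comp_section_comp {i j : I} (hij : i ≤ j) : p j ≫ s j ≫ p i = p i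

namespace IsGroupRetractSystem

variable (h : IsGroupRetractSystem p s)

/-- The group retract of index `i` of a system of group retracts. -/
abbrev grp (i : I) : Grp C :=
  letI := (h.isGroupRetract i).grpObj
  ⟨Z i⟩

/-- The retraction of index `i` of a system of group retracts, as a homomorphism. -/
def proj (i : I) : G ⟶ h.grp i :=
  letI := (h.isGroupRetract i).grpObj
  have : IsMonHom (p i) := isMonHom_of_map_mul _ fun _ ↦ (h.isGroupRetract i).mul_comp
  Grp.homMk (B := h.grp i) (p i)

/-- The homomorphism from the group retract of index `j` to the one of index `i ≤ j`. -/
def transition {i j : I} (hij : i ≤ j) : h.grp j ⟶ h.grp i :=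
  letI := (h.isGroupRetract i).grpObj
  letI := (h.isGroupRetract j).grpObj
  have : IsMonHom (s j ≫ p i : (h.grp j).X ⟶ (h.grp i).X) :=
    isMonHom_of_map_mul _ fun T x y ↦ by
      rw [(h.isGroupRetract j).mul_eq, Category.assoc, h.comp_section_comp hij,
        (h.isGroupRetract i).mul_comp, Category.assoc, Category.assoc]
  Grp.homMk (A := h.grp j) (B := h.grp i) (s j ≫ p i)

/-- The inverse system of groups formed by a system of group retracts. -/
def functor : Iᵒᵖ ⥤ Grp C where
  obj i := h.grp i.unop
  map f := h.transition f.unop.le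
  map_id i := Grp.hom_ext _ _ (h.isGroupRetract i.unop).section_comp_retraction
  map_comp {_ _ _} f g := Grp.hom_ext _ _ <| by
    change s _ ≫ p _ = (s _ ≫ p _) ≫ s _ ≫ p _
    rw [Category.assoc, h.comp_section_comp g.unop.le]

/-- The cone formed by a group and a system of its group retracts. -/
def cone : Cone h.functor where
  pt := G
  π :=
    { app i := h.proj i.unop
      naturality {_ _} f := Grp.hom_ext _ _ <| by
        change 𝟙 _ ≫ p _ = p _ ≫ s _ ≫ p _
        rw [Category.id_comp, h.comp_section_comp f.unop.le] }

lemma nonempty_isLimit_cone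
    (hext : ∀ (T : C) (f g : T ⟶ G.X), (∀ i, f ≫ p i = g ≫ p i) → f = g)
    (hlift : ∀ (T : C) (x : ∀ i, T ⟶ Z i), (∀ i j, i ≤ j → x j ≫ s j ≫ p i = x i) →
      ∃ f : T ⟶ G.X, ∀ i, f ≫ p i = x i) :
    Nonempty (IsLimit h.cone) := by
  have hex (t : Cone h.functor) : ∃ f : t.pt ⟶ G, ∀ i, f ≫ h.cone.π.app i = t.π.app i := by
    obtain ⟨f, hf⟩ := hlift t.pt.X (fun i ↦ (t.π.app (op i)).hom.hom) fun i j hij ↦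
      congrArg (fun x ↦ x.hom.hom) (t.w (homOfLE hij).op)
    have hmul {T : C} (a b : T ⟶ t.pt.X) (i : I) : (a * b) ≫ (t.π.app (op i)).hom.hom =
        (a ≫ (t.π.app (op i)).hom.hom) * (b ≫ (t.π.app (op i)).hom.hom) :=
      MonObj.mul_comp _ _ _
    have : IsMonHom f := by
      refine isMonHom_of_map_mul _ fun T a b ↦ hext _ _ _ fun i ↦ ?_
      let := (h.isGroupRetract i).grpObj
      rw [(h.isGroupRetract i).mul_comp, Category.assoc, Category.assoc, Category.assoc, hf]
      exact hmul a b i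
    exact ⟨Grp.homMk f, fun i ↦ Grp.hom_ext _ _ (hf i.unop)⟩
  choose f hf using hex
  exact ⟨f, hf, fun t g hg ↦ Grp.hom_ext _ _ <| hext _ _ _ fun i ↦
    congrArg (fun x ↦ x.hom.hom) ((hg (op i)).trans (hf t (op i)).symm)⟩

end IsGroupRetractSystem

end RetractTower

/-! ### Power loci -/

section PowLocus

variable {k : Type u} [CommRing k] {e : ℕ → ℕ} {Y : Over (Spec (.of k))}

/-- A morphism `κ : Y ⟶ Spec k[X₀, X₁, …]` is a power locus for the exponents `e` if it identifies
`Y` with the subfunctor where the `e i`-th power of the `i`-th coordinate vanishes for all `i`. -/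
structure IsPowLocus (e : ℕ → ℕ) (κ : Y ⟶ affineSpace k) : Prop where
  mono : Mono κ
  exists_comp_eq_iff {T : Over (Spec (.of k))} (g : T ⟶ affineSpace k) :
    (∃ f : T ⟶ Y, f ≫ κ = g) ↔ ∀ i, homEquiv T g i ^ e i = 0

namespace IsPowLocus

variable {κ : Y ⟶ affineSpace k} (hκ : IsPowLocus e κ)

include hκ

lemma homEquiv_comp_pow_eq_zero {T : Over (Spec (.of k))} (f : T ⟶ Y) (i : ℕ) :
    homEquiv T (f ≫ κ) i ^ e i = 0 :=
  (hκ.exists_comp_eq_iff _).1 ⟨f, rfl⟩ i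

lemma homEquiv_pow_eq_zero (i : ℕ) : homEquiv Y κ i ^ e i = 0 := by
  simpa only [Category.id_comp] using hκ.homEquiv_comp_pow_eq_zero (𝟙 Y) i

/-- The factorization through a power locus of a morphism that lands in it. -/
def lift {T : Over (Spec (.of k))} (g : T ⟶ affineSpace k) (hg : ∀ i, homEquiv T g i ^ e i = 0) :
    T ⟶ Y :=
  ((hκ.exists_comp_eq_iff g).2 hg).choose

lemma lift_comp {T : Over (Spec (.of k))} (g : T ⟶ affineSpace k)
    (hg : ∀ i, homEquiv T g i ^ e i = 0) : hκ.lift g hg ≫ κ = g :=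
  ((hκ.exists_comp_eq_iff g).2 hg).choose_spec

/-- Two power loci for the same exponents are isomorphic. -/
def iso {Y' : Over (Spec (.of k))} {κ' : Y' ⟶ affineSpace k} (hκ' : IsPowLocus e κ') : Y ≅ Y' where
  hom := hκ'.lift κ hκ.homEquiv_pow_eq_zero
  inv := hκ.lift κ' hκ'.homEquiv_pow_eq_zero
  hom_inv_id := by
    have := hκ.mono
    rw [← cancel_mono κ, Category.assoc, lift_comp, lift_comp, Category.id_comp]
  inv_hom_id := by
    have := hκ'.mono
    rw [← cancel_mono κ', Category.assoc, lift_comp, lift_comp, Category.id_comp]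

end IsPowLocus

variable (k e) in
/-- The ideal of `k[X₀, X₁, …]` generated by the powers of the variables with exponents `e`. -/
abbrev powIdeal : Ideal (MvPolynomial ℕ k) := Ideal.span (Set.range fun i : ℕ ↦ X i ^ e i)

variable (k e) in
/-- The closed subscheme of `Spec k[X₀, X₁, …]` where the powers of the coordinates with exponents
`e` vanish. -/
abbrev powScheme : Over (Spec (.of k)) :=
  Over.mk (Spec.map (CommRingCat.ofHom (algebraMap k (MvPolynomial ℕ k ⧸ powIdeal k e))))

variable (k e) in
/-- The inclusion of `powScheme` in `Spec k[X₀, X₁, …]`. -/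
def powInclusion : powScheme k e ⟶ affineSpace k :=
  Over.homMk (Spec.map (CommRingCat.ofHom (Ideal.Quotient.mk (powIdeal k e)))) <| by
    simp only [affineSpace, Over.mk_hom, ← Spec.map_comp, ← CommRingCat.ofHom_comp]
    rfl

lemma mk_X_pow_eq_zero (i : ℕ) : Ideal.Quotient.mk (powIdeal k e) (X i) ^ e i = 0 := by
  rw [← map_pow]
  exact Ideal.Quotient.eq_zero_iff_mem.2 (Ideal.subset_span ⟨i, rfl⟩)

instance : Mono (powInclusion k e) := by
  have : IsClosedImmersion (powInclusion k e).left :=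
    IsClosedImmersion.spec_of_surjective _ Ideal.Quotient.mk_surjective
  exact Over.mono_of_mono_left _

lemma homEquiv_powInclusion_pow_eq_zero (i : ℕ) :
    homEquiv (powScheme k e) (powInclusion k e) i ^ e i = 0 := by
  have h : homEquiv (powScheme k e) (powInclusion k e) i =
      (Scheme.ΓSpecIso (.of (MvPolynomial ℕ k ⧸ powIdeal k e))).inv
        (Ideal.Quotient.mk (powIdeal k e) (X i)) :=
    (ConcreteCategory.congr_hom (Scheme.ΓSpecIso_inv_naturality
      (CommRingCat.ofHom (Ideal.Quotient.mk (powIdeal k e)))) (X i)).symm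
  rw [h]
  exact (map_pow _ _ _).symm.trans ((congrArg _ (mk_X_pow_eq_zero i)).trans (map_zero _))

lemma exists_comp_powInclusion_eq {T : Over (Spec (.of k))} (g : T ⟶ affineSpace k)
    (hg : ∀ i, homEquiv T g i ^ e i = 0) : ∃ f, f ≫ powInclusion k e = g := by
  obtain ⟨v, rfl⟩ := (homEquiv T).symm.surjective g
  simp only [Equiv.apply_symm_apply] at hg
  have hle : powIdeal k e ≤ RingHom.ker (aeval (R := k) (S₁ := sections T) v) := by
    refine Ideal.span_le.2 ?_
    rintro _ ⟨i, rfl⟩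
    exact RingHom.mem_ker.2 (by rw [map_pow, aeval_X]; exact hg i)
  let l := Ideal.Quotient.liftₐ (powIdeal k e) (aeval (R := k) (S₁ := sections T) v) hle
  refine ⟨Over.homMk (T.left.toSpecΓ ≫ Spec.map (CommRingCat.ofHom l.toRingHom)) ?_, ?_⟩
  · refine Eq.trans ?_ (eq_toSpecΓ_comp T.hom).symm
    simp only [Over.mk_hom, Category.assoc, ← Spec.map_comp]
    congr 2
    ext x
    exact l.commutes x
  · ext1
    refine (Category.assoc _ _ _).trans (congrArg (T.left.toSpecΓ ≫ ·) ?_)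
    exact (Spec.map_comp _ _).symm

variable (k e) in
lemma isPowLocus_powInclusion : IsPowLocus e (powInclusion k e) where
  mono := inferInstance
  exists_comp_eq_iff g := by
    refine ⟨?_, exists_comp_powInclusion_eq g⟩
    rintro ⟨f, rfl⟩ i
    rw [homEquiv_comp, ← map_pow, homEquiv_powInclusion_pow_eq_zero, map_zero]

lemma isFinite_powScheme {N : ℕ} (he : ∀ i, e i ≠ 0) (hN : ∀ i, N ≤ i → e i = 1) :
    IsFinite (powScheme k e).hom := by
  let S : Set (MvPolynomial ℕ k ⧸ powIdeal k e) :=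
    (fun i ↦ Ideal.Quotient.mk (powIdeal k e) (X i)) '' Set.Iio N
  have hS : Algebra.adjoin k S = ⊤ := by
    rw [eq_top_iff, ← AlgHom.range_eq_top (Ideal.Quotient.mkₐ k (powIdeal k e)) |>.2
      (Ideal.Quotient.mkₐ_surjective _ _), ← Algebra.map_top, ← MvPolynomial.adjoin_range_X,
      AlgHom.map_adjoin, Algebra.adjoin_le_iff]
    rintro _ ⟨_, ⟨i, rfl⟩, rfl⟩
    by_cases hi : i < N
    · exact Algebra.subset_adjoin ⟨i, hi, rfl⟩
    · have hX := mk_X_pow_eq_zero (k := k) (e := e) i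
      rw [hN i (not_lt.1 hi), pow_one] at hX
      exact hX ▸ zero_mem (Algebra.adjoin k S)
  have hfg : (Subalgebra.toSubmodule (Algebra.adjoin k S)).FG := by
    refine fg_adjoin_of_finite ((Set.finite_Iio N).image _) ?_
    rintro _ ⟨i, _, rfl⟩
    exact .of_pow (Nat.pos_of_ne_zero (he i)) (mk_X_pow_eq_zero (k := k) i ▸ isIntegral_zero)
  rw [hS, Algebra.top_toSubmodule] at hfg
  exact (IsFinite.SpecMap_iff _).2 (RingHom.finite_algebraMap.2 ⟨hfg⟩)

lemma exists_sub_algebraMap_mem_nilradical (a : MvPolynomial ℕ k ⧸ powIdeal k e) :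
    ∃ c : k, a - algebraMap k _ c ∈ nilradical (MvPolynomial ℕ k ⧸ powIdeal k e) := by
  obtain ⟨P, rfl⟩ := Ideal.Quotient.mk_surjective a
  induction P using MvPolynomial.induction_on with
  | C c => exact ⟨c, (sub_self (Ideal.Quotient.mk (powIdeal k e) (C c))).symm ▸ zero_mem _⟩
  | add P Q hP hQ =>
    obtain ⟨c, hc⟩ := hP
    obtain ⟨d, hd⟩ := hQ
    refine ⟨c + d, ?_⟩
    rw [map_add, map_add, add_sub_add_comm]
    exact add_mem hc hd
  | mul_X P i _ =>
    refine ⟨0, ?_⟩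
    rw [map_zero, sub_zero, map_mul]
    exact Ideal.mul_mem_left _ _ ⟨e i, mk_X_pow_eq_zero i⟩

lemma subsingleton_powScheme {k : Type u} [Field k] {e : ℕ → ℕ} :
    Subsingleton (powScheme k e).left := by
  let A := MvPolynomial ℕ k ⧸ powIdeal k e
  have hle (P Q : PrimeSpectrum A) : P.asIdeal ≤ Q.asIdeal := fun a ha ↦ by
    obtain ⟨c, hc⟩ := exists_sub_algebraMap_mem_nilradical a
    have hnil (I : PrimeSpectrum A) : a - algebraMap k A c ∈ I.asIdeal := nilradical_le_prime _ hc
    obtain rfl : c = 0 := by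
      by_contra hc0
      exact P.2.ne_top (Ideal.eq_top_of_isUnit_mem _ ((Submodule.sub_mem_iff_right _ ha).1 (hnil P))
        ((isUnit_iff_ne_zero.2 hc0).map (algebraMap k A)))
    simpa only [map_zero, sub_zero] using hnil Q
  exact ⟨fun P Q ↦ PrimeSpectrum.ext ((hle P Q).antisymm (hle Q P))⟩

end PowLocus

/-! ### Truncation -/

section Truncation

variable {k : Type u} [CommRing k]

variable (k) in
/-- The endomorphism of `Spec k[X₀, X₁, …]` that keeps the first `N` coordinates and replaces the
others by zero. -/
def truncation (N : ℕ) : affineSpace k ⟶ affineSpace k :=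
  affineSpaceMap (aeval fun i ↦ if i < N then X i else 0)

lemma homEquiv_comp_truncation {T : Over (Spec (.of k))} (f : T ⟶ affineSpace k) (N i : ℕ) :
    homEquiv T (f ≫ truncation k N) i = if i < N then homEquiv T f i else 0 := by
  rw [truncation, homEquiv_comp_affineSpaceMap, aeval_X]
  split_ifs
  · exact aeval_X (R := k) (S₁ := sections T) _ i
  · exact map_zero _

lemma comp_truncation_eq_iff {T : Over (Spec (.of k))} {f g : T ⟶ affineSpace k} {N : ℕ} :
    f ≫ truncation k N = g ≫ truncation k N ↔ ∀ i < N, homEquiv T f i = homEquiv T g i := by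
  rw [← (homEquiv T).injective.eq_iff, funext_iff]
  refine forall_congr' fun i ↦ ?_
  rw [homEquiv_comp_truncation, homEquiv_comp_truncation]
  split_ifs with hi <;> simp [hi]

lemma comp_truncation_eq_self_iff {T : Over (Spec (.of k))} {f : T ⟶ affineSpace k} {N : ℕ} :
    f ≫ truncation k N = f ↔ ∀ i, N ≤ i → homEquiv T f i = 0 := by
  rw [← (homEquiv T).injective.eq_iff, funext_iff]
  refine forall_congr' fun i ↦ ?_
  rw [homEquiv_comp_truncation]
  split_ifs with hi
  · simp [hi]
  · simp [not_lt.1 hi, eq_comm]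

lemma truncation_comp_truncation {M N : ℕ} (h : M ≤ N) :
    truncation k N ≫ truncation k M = truncation k M := by
  nth_rw 2 [← Category.id_comp (truncation k M)]
  refine comp_truncation_eq_iff.2 fun i hi ↦ ?_
  rw [← Category.id_comp (truncation k N), homEquiv_comp_truncation, if_pos (hi.trans_le h)]

/-- The exponents `e`, replaced by `1` from the index `N` on, so that the corresponding power locus
is the locus with exponents `e` in which the coordinates of index at least `N` vanish. -/
def truncExponent (e : ℕ → ℕ) (N i : ℕ) : ℕ := if i < N then e i else 1

end Truncation

section PowLocusTower

variable {k : Type u} [CommRing k] {e : ℕ → ℕ} {Y : Over (Spec (.of k))} {κ : Y ⟶ affineSpace k}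

lemma powInclusion_truncExponent_comp_truncation (N : ℕ) :
    powInclusion k (truncExponent e N) ≫ truncation k N = powInclusion k (truncExponent e N) := by
  refine comp_truncation_eq_self_iff.2 fun i hi ↦ ?_
  have h := homEquiv_powInclusion_pow_eq_zero (k := k) (e := truncExponent e N) i
  rwa [truncExponent, if_neg (not_lt.2 hi), pow_one] at h

namespace IsPowLocus

variable (hκ : IsPowLocus e κ)

/-- The retraction of a power locus onto its locus where the coordinates of index at least `N`
vanish. -/
def truncate (N : ℕ) : Y ⟶ powScheme k (truncExponent e N) :=
  (isPowLocus_powInclusion k _).lift (κ ≫ truncation k N) fun i ↦ by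
    rw [homEquiv_comp_truncation, truncExponent]
    split_ifs
    · exact hκ.homEquiv_pow_eq_zero i
    · exact pow_one _

lemma truncate_comp (N : ℕ) :
    hκ.truncate N ≫ powInclusion k (truncExponent e N) = κ ≫ truncation k N :=
  lift_comp _ _ _

/-- The inclusion in a power locus of its locus where the coordinates of index at least `N`
vanish. -/
def extend (he : ∀ i, e i ≠ 0) (N : ℕ) : powScheme k (truncExponent e N) ⟶ Y :=
  hκ.lift (powInclusion k _) fun i ↦ by
    refine pow_eq_zero_of_le ?_ (homEquiv_powInclusion_pow_eq_zero i)
    rw [truncExponent]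
    split_ifs
    exacts [le_rfl, Nat.one_le_iff_ne_zero.2 (he i)]

lemma extend_comp (he : ∀ i, e i ≠ 0) (N : ℕ) :
    hκ.extend he N ≫ κ = powInclusion k (truncExponent e N) :=
  lift_comp _ _ _

lemma comp_truncate_eq_iff {T : Over (Spec (.of k))} {f g : T ⟶ Y} {N : ℕ} :
    f ≫ hκ.truncate N = g ≫ hκ.truncate N ↔
      ∀ i < N, homEquiv T (f ≫ κ) i = homEquiv T (g ≫ κ) i := by
  rw [← cancel_mono (powInclusion k _), Category.assoc, Category.assoc, truncate_comp,
    ← Category.assoc, ← Category.assoc, comp_truncation_eq_iff]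

lemma hom_ext_of_comp_truncate {T : Over (Spec (.of k))} {f g : T ⟶ Y}
    (h : ∀ N, f ≫ hκ.truncate N = g ≫ hκ.truncate N) : f = g := by
  have := hκ.mono
  rw [← cancel_mono κ, ← (homEquiv T).injective.eq_iff]
  funext i
  exact hκ.comp_truncate_eq_iff.1 (h (i + 1)) i i.lt_succ_self

lemma extend_comp_truncate_comp (he : ∀ i, e i ≠ 0) (M N : ℕ) :
    (hκ.extend he N ≫ hκ.truncate M) ≫ powInclusion k _ =
      powInclusion k (truncExponent e N) ≫ truncation k M := by
  rw [Category.assoc, truncate_comp, ← Category.assoc, extend_comp]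

lemma extend_comp_truncate_self (he : ∀ i, e i ≠ 0) (N : ℕ) :
    hκ.extend he N ≫ hκ.truncate N = 𝟙 _ := by
  rw [← cancel_mono (powInclusion k _), extend_comp_truncate_comp,
    powInclusion_truncExponent_comp_truncation, Category.id_comp]

lemma truncate_comp_extend_comp_truncate (he : ∀ i, e i ≠ 0) {M N : ℕ} (h : M ≤ N) :
    hκ.truncate N ≫ hκ.extend he N ≫ hκ.truncate M = hκ.truncate M := by
  rw [← cancel_mono (powInclusion k _), Category.assoc, extend_comp_truncate_comp,
    ← Category.assoc, truncate_comp, truncate_comp, Category.assoc, truncation_comp_truncation h]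

lemma exists_comp_truncate_eq (he : ∀ i, e i ≠ 0) {T : Over (Spec (.of k))}
    (x : ∀ N, T ⟶ powScheme k (truncExponent e N))
    (hx : ∀ M N, M ≤ N → x N ≫ hκ.extend he N ≫ hκ.truncate M = x M) :
    ∃ f : T ⟶ Y, ∀ N, f ≫ hκ.truncate N = x N := by
  let v (i : ℕ) : sections T := homEquiv T (x (i + 1) ≫ powInclusion k _) i
  have hv (i : ℕ) : v i ^ e i = 0 := by
    have h := (isPowLocus_powInclusion k (truncExponent e (i + 1))).homEquiv_comp_pow_eq_zero
      (x (i + 1)) i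
    rwa [truncExponent, if_pos i.lt_succ_self] at h
  have hvx {N i : ℕ} (hi : i < N) : v i = homEquiv T (x N ≫ powInclusion k _) i := by
    simp only [v, ← hx (i + 1) N hi]
    rw [Category.assoc, extend_comp_truncate_comp, ← Category.assoc, homEquiv_comp_truncation,
      if_pos i.lt_succ_self]
  refine ⟨hκ.lift ((homEquiv T).symm v) (by simpa only [Equiv.apply_symm_apply] using hv),
    fun N ↦ ?_⟩
  rw [← cancel_mono (powInclusion k _), Category.assoc, truncate_comp, ← Category.assoc, lift_comp,
    ← powInclusion_truncExponent_comp_truncation, ← Category.assoc, comp_truncation_eq_iff]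
  intro i hi
  rw [Equiv.apply_symm_apply, hvx hi]

lemma isGroupRetract_truncate [GrpObj Y] (hmul : IsTriangular κ) (he : ∀ i, e i ≠ 0) (N : ℕ) :
    IsGroupRetract (hκ.truncate N) (hκ.extend he N) where
  section_comp_retraction := hκ.extend_comp_truncate_self he N
  mul_congr T a a' b b' ha hb := by
    rw [comp_truncate_eq_iff] at ha hb ⊢
    exact fun i hi ↦ hmul.mul_congr (fun j hj ↦ ha j (hj.trans_lt hi))
      fun j hj ↦ hb j (hj.trans_lt hi)

lemma isProInfinitesimal {k : Type u} [Field k] {G : Grp (Over (Spec (.of k)))}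
    {κ : G.X ⟶ affineSpace k} (hκ : IsPowLocus e κ) (hmul : IsTriangular κ) (he : ∀ i, e i ≠ 0) :
    IsProInfinitesimal G := by
  have h : IsGroupRetractSystem (fun N : ULift.{u} ℕ ↦ hκ.truncate N.down)
      fun N ↦ hκ.extend he N.down :=
    { isGroupRetract N := hκ.isGroupRetract_truncate hmul he N.down
      comp_section_comp hMN := hκ.truncate_comp_extend_comp_truncate he hMN }
  refine ⟨_, _, inferInstance, h.functor, h.cone, fun N ↦ ⟨?_, subsingleton_powScheme⟩,
    h.nonempty_isLimit_cone (fun T f g hfg ↦ ?_) (fun T x hx ↦ ?_), ⟨Iso.refl _⟩⟩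
  · refine isFinite_powScheme (N := N.unop.down) (fun i ↦ ?_) fun i hi ↦ if_neg (not_lt.2 hi)
    rw [truncExponent]
    split_ifs
    exacts [he i, one_ne_zero]
  · exact hκ.hom_ext_of_comp_truncate fun N ↦ hfg ⟨N⟩
  · obtain ⟨f, hf⟩ := hκ.exists_comp_truncate_eq he (fun N ↦ x ⟨N⟩) fun M N ↦ hx ⟨M⟩ ⟨N⟩
    exact ⟨f, fun N ↦ hf N.down⟩

end IsPowLocus

end PowLocusTower

section DrinfeldKernel

open IsLocalRing (ResidueField)

variable {O O' : Type u} [CommRing O] [IsDomain O] [IsDiscreteValuationRing O]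
  [Finite (ResidueField O)] [CommRing O'] [IsDomain O'] [IsDiscreteValuationRing O']
  [Finite (ResidueField O')] [Algebra O O'] [Module.Finite O O'] [FaithfulSMul O O']
  {π : O} {ϖ : O'}

/-- The Witt vector coordinates on the kernel of Drinfeld's morphism on special fibers. -/
def kernelCoords (hπ : Irreducible π) (hϖ : Irreducible ϖ) {r : ℕ}
    (hr : resCard O' = resCard O ^ r) :
    (kernel (drinfeldSpecialFiber hπ hϖ hr)).X ⟶ affineSpace (ResidueField O') :=
  (kernel.ι (drinfeldSpecialFiber hπ hϖ hr)).hom.hom ≫ wittFiberCoords O' hπ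

lemma isTriangular_kernelCoords (hπ : Irreducible π) (hϖ : Irreducible ϖ) {r : ℕ}
    (hr : resCard O' = resCard O ^ r) : IsTriangular (kernelCoords hπ hϖ hr) :=
  (isTriangular_wittFiberCoords hπ).comp (kernel.ι (drinfeldSpecialFiber hπ hϖ hr)).hom.hom

lemma isPowLocus_kernelCoords [Algebra.Unramified O O'] (hπ : Irreducible π) (hϖ : Irreducible ϖ)
    {r : ℕ} (hr : resCard O' = resCard O ^ r) :
    IsPowLocus (fun i ↦ resCard O ^ (i * (r - 1))) (kernelCoords hπ hϖ hr) where
  mono := mono_comp _ _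
  exists_comp_eq_iff {T} g := by
    let κ := wittFiberCoords O' hπ
    have hg : (g ≫ inv κ) ≫ κ = g := by
      rw [Category.assoc, IsIso.inv_hom_id, Category.comp_id]
    have h := comp_drinfeldSpecialFiber_eq_one_iff hπ hϖ hr (g ≫ inv κ)
    rw [hg] at h
    rw [← h, ← exists_comp_kernel_ι_eq_iff]
    refine exists_congr fun f ↦ ?_
    rw [kernelCoords, ← Category.assoc, ← cancel_mono κ, hg]

end DrinfeldKernel

end RamifiedWitt

end

theorem mainTheorem4_general {O O' : Type u}
    [CommRing O] [IsDomain O] [IsDiscreteValuationRing O] [Finite (IsLocalRing.ResidueField O)]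
    [CommRing O'] [IsDomain O'] [IsDiscreteValuationRing O']
    [Finite (IsLocalRing.ResidueField O')]
    [Algebra O O'] [Module.Finite O O'] [FaithfulSMul O O'] [Algebra.Unramified O O']
    {π : O} (hπ : Irreducible π) {ϖ : O'} (hϖ : Irreducible ϖ) {r : ℕ}
    (hr : Nat.card (IsLocalRing.ResidueField O') = Nat.card (IsLocalRing.ResidueField O) ^ r) :
    RamifiedWitt.IsUniversalHomeomorphism
        (RamifiedWitt.drinfeldSpecialFiber hπ hϖ hr).hom.hom.left ∧
      RamifiedWitt.IsProInfinitesimal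
        (CategoryTheory.Limits.kernel (RamifiedWitt.drinfeldSpecialFiber hπ hϖ hr)) ∧
      Nonempty ((CategoryTheory.Limits.kernel (RamifiedWitt.drinfeldSpecialFiber hπ hϖ hr)).X ≅
        CategoryTheory.Over.mk (AlgebraicGeometry.Spec.map (CommRingCat.ofHom
          (algebraMap (IsLocalRing.ResidueField O')
            (MvPolynomial ℕ (IsLocalRing.ResidueField O') ⧸
              Ideal.span (Set.range fun i : ℕ ↦
                (MvPolynomial.X i : MvPolynomial ℕ (IsLocalRing.ResidueField O')) ^
                  Nat.card (IsLocalRing.ResidueField O) ^ (i * (r - 1)))))))) := by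
  have hκ := RamifiedWitt.isPowLocus_kernelCoords hπ hϖ hr
  refine ⟨RamifiedWitt.isUniversalHomeomorphism_drinfeldSpecialFiber hπ hϖ hr,
    hκ.isProInfinitesimal (RamifiedWitt.isTriangular_kernelCoords hπ hϖ hr) fun i ↦ ?_,
    ⟨hκ.iso (RamifiedWitt.isPowLocus_powInclusion _ _)⟩⟩
  exact pow_ne_zero _ RamifiedWitt.WittVec.resCard_ne_zero

theorem mainTheorem4 {O O' : Type u}
    [CommRing O] [IsDomain O] [IsDiscreteValuationRing O]
    [IsAdicComplete (IsLocalRing.maximalIdeal O) O] [Finite (IsLocalRing.ResidueField O)]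
    [CommRing O'] [IsDomain O'] [IsDiscreteValuationRing O']
    [Finite (IsLocalRing.ResidueField O')]
    [Algebra O O'] [Module.Finite O O'] [FaithfulSMul O O'] [Algebra.Unramified O O']
    {π : O} (hπ : Irreducible π) {ϖ : O'} (hϖ : Irreducible ϖ) {r : ℕ}
    (hr : Nat.card (IsLocalRing.ResidueField O') = Nat.card (IsLocalRing.ResidueField O) ^ r) :
    RamifiedWitt.IsUniversalHomeomorphism
        (RamifiedWitt.drinfeldSpecialFiber hπ hϖ hr).hom.hom.left ∧
      RamifiedWitt.IsProInfinitesimal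
        (CategoryTheory.Limits.kernel (RamifiedWitt.drinfeldSpecialFiber hπ hϖ hr)) ∧
      Nonempty ((CategoryTheory.Limits.kernel (RamifiedWitt.drinfeldSpecialFiber hπ hϖ hr)).X ≅
        CategoryTheory.Over.mk (AlgebraicGeometry.Spec.map (CommRingCat.ofHom
          (algebraMap (IsLocalRing.ResidueField O')
            (MvPolynomial ℕ (IsLocalRing.ResidueField O') ⧸
              Ideal.span (Set.range fun i : ℕ ↦
                (MvPolynomial.X i : MvPolynomial ℕ (IsLocalRing.ResidueField O')) ^
                  Nat.card (IsLocalRing.ResidueField O) ^ (i * (r - 1)))))))) :=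
  mainTheorem4_general hπ hϖ hr
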